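/- Let $n,s\ge 0$ and $J\ge 1$ be integers. For $j=1,\dots,J$ let $\mathcal S_j\subseteq\{1,\dots,n\}$ be a set of at most $s$ qubits, let $h_{(j)}$ be a positive semi-definite matrix acting on the qubits of $\mathcal S_j$ (so of size $2^{|\mathcal S_j|}\times 2^{|\mathcal S_j|}$) with operator norm $\|h_{(j)}\|\le 2$, and let $H_{(j)}=h_{(j)}\otimes I_{\neg\mathcal S_j}$ be the operator on $n$ qubits that applies $h_{(j)}$ to the qubits of $\mathcal S_j$. Put $A=\sum_{j=1}^J H_{(j)}\in\mathbb C^{2^n\times 2^n}$ and $B=I-\frac1J A$. With $w_{(j)}=I-h_{(j)}$ let $$u_{(j)}=\begin{pmatrix} w_{(j)} & -\sqrt{I-w_{(j)}^2}\\ \sqrt{I-w_{(j)}^2} & w_{(j)}\end{pmatrix}$$ be the dilation of $w_{(j)}$, which acts on the qubits of $\mathcal S_j$ and on one ancilla qubit (the same for all $j$), and let $U_{(j)}=u_{(j)}\otimes I_{\neg\mathcal S_j}$. On a control register of $\lceil\log_2 J\rceil$ further qubits, whose first $J$ basis states are denoted $|1\rangle_c,\dots,|J\rangle_c$ (the first of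 them being the all-zeros state $|0\cdots0\rangle_c$), let $U_{\textsc{Select}}=\sum_{j=1}^J|j\rangle\langle j|_c\otimes U_{(j)}$, extended by the identity on the remaining basis states of the control register. For a unitary $\mathrm{Had}$ on the control register with $\mathrm{Had}\,|0\cdots0\rangle_c=\frac1{\sqrt J}\sum_{j=1}^J|j\rangle_c$ put $\mathcal U_B=(\mathrm{Had}^\dagger\otimes I)\,U_{\textsc{Select}}\,(\mathrm{Had}\otimes I)$. Then: 1. For every such $\mathrm{Had}$, the operator $\mathcal U_B$ is a normalised (exact) matrix-block-encoding of $B$ with $a=\lceil\log_2 J\rceil+1$ ancilla qubits, that is, $\mathcal U_B$ is unitary and $(\langle 0^a|\otimes I)\,\mathcal U_B\,(|0^a\rangle\otimes I)=B$. 2. The gate complexity is in $O(J\,2^{2s})$, assuming exact single-qubit rotations: there is an absolute constant $C$ (independent of $n$, $s$, $J$, the sets $\mathcal S_j$ and the matrices $h_{(j)}$) such that, for a suitable $\mathrm{Had}$, the operator $\mathcal U_B$ is implemented exactly by a circuit of at most $C\,J\,2^{2s}$ elementary gates. Here the elementary gates are the exact single-qubit rotations $e^{-i\theta X/2}$, $e^{-i\theta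 Y/2}$, $e^{-i\theta Z/2}$ ($\theta\in\mathbb R$) and the controlled-nots between arbitrary pairs of qubits, and the circuit may use additional work qubits that are in the state $|0\rangle$ both before and after its application. -/

import Mathlib

open scoped Matrix.Norms.L2Operator MatrixOrder ComplexOrder

namespace BlockEnc

/-- Operators on a register of qubits labelled by `Q`, as matrices in the computational basis:
a basis state is a bit string `Q → Fin 2`, so for `Q = Fin n` these are the `2^n × 2^n` matrices. -/
abbrev Op (Q : Type) : Type := Matrix (Q → Fin 2) (Q → Fin 2) ℂ

section Embedding

variable {K Q : Type} [Fintype K] [DecidableEq K] [Fintype Q] [DecidableEq Q]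

/-- `M ⊗ I`: the operator `M` applied to the qubits `f k` (`k : K`) of the register `Q`, and the
identity on all the other qubits. -/
noncomputable def onQubits (f : K ↪ Q) (M : Op K) : Op Q :=
  Matrix.of fun x y =>
    open Classical in
    if ∀ q, q ∉ Set.range f → x q = y q then M (fun k => x (f k)) (fun k => y (f k)) else 0

end Embedding

/-! ### Elementary gates and circuits -/

/-- Elementary gates on the qubits `Q`: exact single-qubit rotations about the three axes, and
controlled-nots between arbitrary pairs of distinct qubits. -/
inductive Gate (Q : Type) : Type
  | rotX (θ : ℝ) (q : Q) : Gate Q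
  | rotY (θ : ℝ) (q : Q) : Gate Q
  | rotZ (θ : ℝ) (q : Q) : Gate Q
  | cnot (control target : Q) (h : control ≠ target) : Gate Q

/-- `exp(-i θ X / 2)` -/
noncomputable def rotXMatrix (θ : ℝ) : Matrix (Fin 2) (Fin 2) ℂ :=
  !![(Real.cos (θ / 2) : ℂ), -Complex.I * (Real.sin (θ / 2) : ℂ);
     -Complex.I * (Real.sin (θ / 2) : ℂ), (Real.cos (θ / 2) : ℂ)]

/-- `exp(-i θ Y / 2)` -/
noncomputable def rotYMatrix (θ : ℝ) : Matrix (Fin 2) (Fin 2) ℂ :=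
  !![(Real.cos (θ / 2) : ℂ), -(Real.sin (θ / 2) : ℂ);
     (Real.sin (θ / 2) : ℂ), (Real.cos (θ / 2) : ℂ)]

/-- `exp(-i θ Z / 2)` -/
noncomputable def rotZMatrix (θ : ℝ) : Matrix (Fin 2) (Fin 2) ℂ :=
  !![Complex.exp (-Complex.I * ((θ / 2 : ℝ) : ℂ)), 0;
     0, Complex.exp (Complex.I * ((θ / 2 : ℝ) : ℂ))]

section Circuits

variable {Q : Type} [Fintype Q] [DecidableEq Q]

/-- The single-qubit operator `M` applied to the qubit `q`. -/
def onQubit (q : Q) (M : Matrix (Fin 2) (Fin 2) ℂ) : Op Q :=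
  Matrix.of fun x y => if ∀ r, r ≠ q → x r = y r then M (x q) (y q) else 0

/-- `|y⟩ ↦ |y'⟩` where `y'` is `y` with the target bit replaced by `target XOR control`
(addition in `Fin 2`). -/
def cnotMatrix (control target : Q) : Op Q :=
  Matrix.of fun x y => if x = Function.update y target (y target + y control) then 1 else 0

noncomputable def Gate.matrix : Gate Q → Op Q
  | .rotX θ q => onQubit q (rotXMatrix θ)
  | .rotY θ q => onQubit q (rotYMatrix θ)
  | .rotZ θ q => onQubit q (rotZMatrix θ)
  | .cnot c t _ => cnotMatrix c t

/-- The operator of a circuit, a list of elementary gates; the head of the list is applied first.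
The gate complexity of the circuit is the length of the list. -/
noncomputable def circuitMatrix : List (Gate Q) → Op Q
  | [] => 1
  | g :: C => circuitMatrix C * g.matrix

end Circuits

section Encoding

variable {Q R W : Type} [Fintype Q] [DecidableEq Q] [Fintype R] [DecidableEq R]
  [Fintype W] [DecidableEq W]

/-- The circuit `C` on the qubits `Q` and the work qubits `W` implements the operator `U` on `Q`
exactly, the work qubits being in `|0⟩` both before and after:
`C (|y⟩ ⊗ |0⟩) = (U |y⟩) ⊗ |0⟩`. -/
def Implements (C : List (Gate (Q ⊕ W))) (U : Op Q) : Prop :=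
  ∀ (x y : Q → Fin 2) (z : W → Fin 2),
    circuitMatrix C (Sum.elim x z) (Sum.elim y fun _ => 0) = if z = 0 then U x y else 0

/-- `(⟨0^a| ⊗ I) U (|0^a⟩ ⊗ I)`, where `R` is the ancilla register. -/
def zeroBlock (U : Op (Q ⊕ R)) : Op Q :=
  Matrix.of fun x y => U (Sum.elim x fun _ => 0) (Sum.elim y fun _ => 0)

/-- The unitary `U` on the qubits `Q` and the `a` ancilla qubits `R` is an
`(α, a, ε)`-matrix-block-encoding of `A` (the norm is the operator norm). -/
def IsMatrixBlockEncoding (α : ℝ) (a : ℕ) (ε : ℝ) (U : Op (Q ⊕ R)) (A : Op Q) : Prop :=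
  Fintype.card R = a ∧ U ∈ Matrix.unitaryGroup (Q ⊕ R → Fin 2) ℂ ∧
    ‖A - (α : ℂ) • zeroBlock U‖ ≤ ε

end Encoding

/-! ### The linear combination of the dilations -/

section Dilation

variable {K : Type} [Fintype K] [DecidableEq K]

/-- The dilation `[[w, -√(1 - w²)], [√(1 - w²), w]]` of `w`, on the qubits `K` and one ancilla;
the blocks are indexed by the value of the ancilla. -/
noncomputable def dilation (w : Op K) : Op (K ⊕ Unit) :=
  let r : Op K := CFC.sqrt (1 - w * w)
  let side : (K ⊕ Unit → Fin 2) → (K → Fin 2) ⊕ (K → Fin 2) := fun x =>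
    if x (Sum.inr ()) = 0 then Sum.inl (x ∘ Sum.inl) else Sum.inr (x ∘ Sum.inl)
  (Matrix.fromBlocks w (-r) r w).submatrix side side

end Dilation

section LCU

variable {n J : ℕ}

/-- `H = h ⊗ I` acting on the qubits of `S`. -/
noncomputable def localTerm (S : Finset (Fin n)) (h : Op S) : Op (Fin n) :=
  onQubits (Function.Embedding.subtype (· ∈ S)) h

/-- The number of qubits of the control register. -/
abbrev ctrlSize (J : ℕ) : ℕ := Nat.clog 2 J

/-- The ancilla register: one qubit for the dilations, shared by all of them, and the control
register. -/
abbrev Anc (J : ℕ) : Type := Unit ⊕ Fin (ctrlSize J)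

/-- The binary encoding of the label `j` in the control register. -/
def label (j : Fin J) : Fin (ctrlSize J) → Fin 2 := fun i =>
  if (j : ℕ).testBit i then 1 else 0

def ctrlQubits (n J : ℕ) : Fin (ctrlSize J) ↪ Fin n ⊕ Anc J where
  toFun i := Sum.inr (Sum.inr i)
  inj' := fun _ _ h => Sum.inr_injective (Sum.inr_injective h)

def dilationQubits (J : ℕ) (S : Finset (Fin n)) : S ⊕ Unit ↪ Fin n ⊕ Anc J where
  toFun := Sum.map Subtype.val Sum.inl
  inj' := Function.Injective.sumMap Subtype.val_injective Sum.inl_injective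

/-- `|j⟩⟨j|` on the control register. -/
noncomputable def ctrlProj (n : ℕ) (j : Fin J) : Op (Fin n ⊕ Anc J) :=
  onQubits (ctrlQubits n J) (Matrix.single (label j) (label j) 1)

/-- `∑ⱼ |j⟩⟨j| ⊗ Uⱼ`, where `Uⱼ` is the dilation of `1 - hⱼ` applied to the qubits of `S j` and the
dilation ancilla; extended by the identity to the control states that label no `j`. -/
noncomputable def selectOp (S : Fin J → Finset (Fin n)) (h : ∀ j, Op (S j)) :
    Op (Fin n ⊕ Anc J) :=
  ∑ j, ctrlProj n j * onQubits (dilationQubits J (S j)) (dilation (1 - h j)) +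
    (1 - ∑ j, ctrlProj n j)

/-- A unitary on the control register with `Had |0⟩ = ∑ⱼ |j⟩ / √J`. -/
def IsUniformPrep (J : ℕ) (had : Op (Fin (ctrlSize J))) : Prop :=
  had ∈ Matrix.unitaryGroup (Fin (ctrlSize J) → Fin 2) ℂ ∧
    had.mulVec (Pi.single 0 1) = ∑ j : Fin J, ((1 / Real.sqrt J : ℝ) : ℂ) • Pi.single (label j) 1

/-- `(Hadᴴ ⊗ 1) Select (Had ⊗ 1)`. -/
noncomputable def lcuOp (had : Op (Fin (ctrlSize J))) (S : Fin J → Finset (Fin n))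
    (h : ∀ j, Op (S j)) : Op (Fin n ⊕ Anc J) :=
  onQubits (ctrlQubits n J) had.conjTranspose * selectOp S h * onQubits (ctrlQubits n J) had

end LCU

end BlockEnc

set_option linter.unusedSectionVars false

namespace BlockEnc

/-! ### Operators on part of a register -/

section OnQubits

variable {K Q : Type} [Fintype K] [DecidableEq K] [Fintype Q] [DecidableEq Q]

/-! The block-encoding identity is the linear-combination-of-unitaries computation. `Had` sends
`|0⟩` to the uniform superposition, `Select` is block diagonal in the control register, and the
top-left block of the `j`-th dilation is `1 - h j`. Sandwiching gives `(1/J) ∑ (1 - H j) = 1 - A/J`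
(`zeroBlock_lcuOp`). Only the first column of `Had` enters, so any admissible `Had` works. Unitarity
of `Select` is read off from a circuit that implements it.

The gate count avoids compiling arbitrary unitaries. In an eigenbasis `v i` of `h` the dilation is
`∑ |v i⟩⟨v i| ⊗ R_Y(θ i)`, a product of `2^|S|` commuting rotations of the ancilla, each conditioned
on one eigenvector (`exists_dilation_eq`). Such a conditioned rotation is a rotation conditioned on
`|0⟩`, conjugated by a circuit preparing `v i`. Uniformly controlled rotations
(`exists_circuit_mux`) and state preparation (`exists_circuit_prepare`) each cost `O(2^|S|)`, so one
controlled dilation costs `O(4^|S|)` (`exists_circuit_controlled_dilation`).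

The choice of `j` is made by unary iteration (`exists_circuit_selectFrom`): a binary tree over the
label bits, whose work qubits flag the prefix read so far. Each node costs a constant number of
gates, so no factor `log J` appears, and the tree has fewer than `2J` leaves when `J > 1`, and one
when `J = 1`. Preparing the uniform superposition costs `O(J)`.

Circuits with work qubits are handled as intertwining relations with the isometries `withWork Q a`,
for which composition is associativity of matrix products. -/

theorem onQubits_apply_of_agree (f : K ↪ Q) (M : Op K) {x y : Q → Fin 2}
    (h : ∀ q, q ∉ Set.range f → x q = y q) : onQubits f M x y = M (x ∘ f) (y ∘ f) :=
  if_pos h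

theorem onQubits_apply_of_not_agree (f : K ↪ Q) (M : Op K) {x y : Q → Fin 2}
    (h : ¬∀ q, q ∉ Set.range f → x q = y q) : onQubits f M x y = 0 :=
  if_neg h

theorem extend_comp_embedding (f : K ↪ Q) (u : K → Fin 2) (x : Q → Fin 2) :
    Function.extend f u x ∘ f = u :=
  funext fun k => f.injective.extend_apply u x k

theorem extend_apply_notMem (f : K ↪ Q) (u : K → Fin 2) (x : Q → Fin 2) {q : Q}
    (hq : q ∉ Set.range f) : Function.extend f u x q = x q :=
  Function.extend_apply' _ _ _ (by simpa using hq)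

theorem extend_self_of_agree (f : K ↪ Q) {x y : Q → Fin 2}
    (h : ∀ q, q ∉ Set.range f → x q = y q) : Function.extend f (y ∘ f) x = y := by
  funext q
  by_cases hq : q ∈ Set.range f
  · obtain ⟨k, rfl⟩ := hq
    exact f.injective.extend_apply _ _ _
  · rw [extend_apply_notMem f _ _ hq, h q hq]

theorem extend_injective_left (f : K ↪ Q) (x : Q → Fin 2) :
    Function.Injective fun u : K → Fin 2 => Function.extend f u x := fun u v h => by
  have := congrArg (· ∘ f) h
  simpa only [extend_comp_embedding] using this

/-- A product with a local operator is a sum over the states of the qubits it acts on. -/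
theorem onQubits_mul_apply {ι : Type*} (f : K ↪ Q) (M : Op K) (A : Matrix (Q → Fin 2) ι ℂ)
    (x : Q → Fin 2) (i : ι) :
    (onQubits f M * A) x i = ∑ u, M (x ∘ f) u * A (Function.extend f u x) i := by
  classical
  rw [Matrix.mul_apply]
  symm
  refine Finset.sum_of_injOn (fun u => Function.extend f u x)
    (fun u _ v _ h => extend_injective_left f x h) (fun _ _ => Finset.mem_coe.2 (Finset.mem_univ _)) ?_ ?_
  · intro z _ hz
    rw [onQubits_apply_of_not_agree, zero_mul]
    exact fun h => hz ⟨z ∘ f, by simp, extend_self_of_agree f h⟩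
  · intro u _
    rw [onQubits_apply_of_agree f M fun q hq => (extend_apply_notMem f u x hq).symm,
      extend_comp_embedding]

theorem onQubits_mul (f : K ↪ Q) (M N : Op K) :
    onQubits f (M * N) = onQubits f M * onQubits f N := by
  ext x y
  rw [onQubits_mul_apply]
  by_cases h : ∀ q, q ∉ Set.range f → x q = y q
  · rw [onQubits_apply_of_agree f _ h, Matrix.mul_apply]
    refine Finset.sum_congr rfl fun u _ => ?_
    rw [onQubits_apply_of_agree f N, extend_comp_embedding]
    intro q hq
    rw [extend_apply_notMem f u x hq, h q hq]
  · rw [onQubits_apply_of_not_agree f _ h]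
    symm
    refine Finset.sum_eq_zero fun u _ => ?_
    rw [onQubits_apply_of_not_agree, mul_zero]
    exact fun h' => h fun q hq => by rw [← h' q hq, extend_apply_notMem f u x hq]

theorem onQubits_one (f : K ↪ Q) : onQubits f (1 : Op K) = 1 := by
  ext x y
  by_cases h : ∀ q, q ∉ Set.range f → x q = y q
  · rw [onQubits_apply_of_agree f _ h, Matrix.one_apply, Matrix.one_apply]
    refine if_congr ⟨fun h' => ?_, fun h' => by rw [h']⟩ rfl rfl
    rw [← extend_self_of_agree f h, ← h', extend_self_of_agree f fun _ _ => rfl]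
  · rw [onQubits_apply_of_not_agree f _ h, Matrix.one_apply_ne]
    rintro rfl
    exact h fun _ _ => rfl

theorem onQubits_conjTranspose (f : K ↪ Q) (M : Op K) :
    onQubits f M.conjTranspose = (onQubits f M).conjTranspose := by
  ext x y
  rw [Matrix.conjTranspose_apply]
  by_cases h : ∀ q, q ∉ Set.range f → x q = y q
  · rw [onQubits_apply_of_agree f _ h, onQubits_apply_of_agree f _ fun q hq => (h q hq).symm,
      Matrix.conjTranspose_apply]
  · rw [onQubits_apply_of_not_agree f _ h, onQubits_apply_of_not_agree f _ fun h' =>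
      h fun q hq => (h' q hq).symm, star_zero]

theorem onQubits_add (f : K ↪ Q) (M N : Op K) :
    onQubits f (M + N) = onQubits f M + onQubits f N := by
  ext x y
  by_cases h : ∀ q, q ∉ Set.range f → x q = y q
  · simp [onQubits_apply_of_agree f _ h]
  · simp [onQubits_apply_of_not_agree f _ h]

theorem onQubits_smul (f : K ↪ Q) (c : ℂ) (M : Op K) :
    onQubits f (c • M) = c • onQubits f M := by
  ext x y
  by_cases h : ∀ q, q ∉ Set.range f → x q = y q
  · simp [onQubits_apply_of_agree f _ h]
  · simp [onQubits_apply_of_not_agree f _ h]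

theorem onQubits_zero (f : K ↪ Q) : onQubits f (0 : Op K) = 0 := by
  simpa using onQubits_smul f 0 0

theorem onQubits_sub (f : K ↪ Q) (M N : Op K) :
    onQubits f (M - N) = onQubits f M - onQubits f N := by
  rw [eq_sub_iff_add_eq, ← onQubits_add, sub_add_cancel]

theorem onQubits_sum {ι : Type*} (f : K ↪ Q) (s : Finset ι) (M : ι → Op K) :
    onQubits f (∑ i ∈ s, M i) = ∑ i ∈ s, onQubits f (M i) :=
  map_sum (AddMonoidHom.mk' (onQubits f) (onQubits_add f)) M s

theorem onQubits_mem_unitaryGroup (f : K ↪ Q) {M : Op K}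
    (hM : M ∈ Matrix.unitaryGroup (K → Fin 2) ℂ) :
    onQubits f M ∈ Matrix.unitaryGroup (Q → Fin 2) ℂ := by
  rw [Matrix.mem_unitaryGroup_iff, Matrix.star_eq_conjTranspose] at hM ⊢
  rw [← onQubits_conjTranspose, ← onQubits_mul, hM, onQubits_one]

end OnQubits

/-! ### Multiplexed single-qubit operators -/

section Mux

variable {K Q : Type} [Fintype K] [DecidableEq K] [Fintype Q] [DecidableEq Q]

/-- The single-qubit operator `R x` applied to the qubit `t`, where `x` is the state of the other
qubits. -/
def mux (t : Q) (R : (Q → Fin 2) → Matrix (Fin 2) (Fin 2) ℂ) : Op Q :=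
  Matrix.of fun x y => if ∀ r, r ≠ t → x r = y r then R x (x t) (y t) else 0

theorem onQubit_eq_mux (t : Q) (M : Matrix (Fin 2) (Fin 2) ℂ) : onQubit t M = mux t fun _ => M :=
  rfl

theorem mux_mul_apply {ι : Type*} (t : Q) (R : (Q → Fin 2) → Matrix (Fin 2) (Fin 2) ℂ)
    (A : Matrix (Q → Fin 2) ι ℂ) (x : Q → Fin 2) (i : ι) :
    (mux t R * A) x i = ∑ b, R x (x t) b * A (Function.update x t b) i := by
  rw [Matrix.mul_apply]
  symm
  refine Finset.sum_of_injOn (fun b => Function.update x t b)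
    (fun u _ v _ h => Function.update_injective x t h)
    (fun _ _ => Finset.mem_coe.2 (Finset.mem_univ _)) ?_ ?_
  · intro z _ hz
    rw [mux, Matrix.of_apply, if_neg, zero_mul]
    refine fun h => hz ⟨z t, by simp, ?_⟩
    funext r
    by_cases hr : r = t
    · subst hr; simp
    · simp [hr, h r hr]
  · intro b _
    rw [mux, Matrix.of_apply, if_pos, Function.update_self]
    intro r hr
    simp [hr]

theorem mux_mulVec_apply (t : Q) (R : (Q → Fin 2) → Matrix (Fin 2) (Fin 2) ℂ)
    (v : (Q → Fin 2) → ℂ) (x : Q → Fin 2) :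
    (mux t R).mulVec v x = ∑ b, R x (x t) b * v (Function.update x t b) := by
  have := mux_mul_apply t R (Matrix.replicateCol Unit v) x ()
  simpa [Matrix.mul_apply, Matrix.mulVec, dotProduct] using this

/-- The right factor is evaluated at a state whose target bit has been replaced, so the product is
pointwise only if `R'` ignores that bit. -/
theorem mux_mul_mux (t : Q) (R R' : (Q → Fin 2) → Matrix (Fin 2) (Fin 2) ℂ)
    (hR' : ∀ x b, R' (Function.update x t b) = R' x) :
    mux t R * mux t R' = mux t fun x => R x * R' x := by
  ext x y
  rw [mux_mul_apply]
  simp only [mux, Matrix.of_apply, hR', Function.update_self]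
  have h : ∀ b, (∀ r, r ≠ t → Function.update x t b r = y r) ↔ ∀ r, r ≠ t → x r = y r :=
    fun b => forall₂_congr fun r hr => by rw [Function.update_of_ne hr]
  simp only [h]
  split_ifs
  · rw [Matrix.mul_apply]
  · simp

theorem mux_one (t : Q) : mux t (fun _ => 1) = (1 : Op Q) := by
  ext x y
  rw [mux, Matrix.of_apply, Matrix.one_apply, Matrix.one_apply]
  by_cases h : x = y
  · simp [h]
  · rw [if_neg h]
    split_ifs with h1 h2
    · refine absurd (funext fun r => ?_) h
      by_cases hr : r = t
      · rw [hr, h2]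
      · exact h1 r hr
    · rfl
    · rfl

theorem mux_conjTranspose (t : Q) (R : (Q → Fin 2) → Matrix (Fin 2) (Fin 2) ℂ)
    (hR : ∀ x b, R (Function.update x t b) = R x) :
    (mux t R).conjTranspose = mux t fun x => (R x).conjTranspose := by
  ext x y
  simp only [Matrix.conjTranspose_apply, mux, Matrix.of_apply]
  by_cases h : ∀ r, r ≠ t → x r = y r
  · rw [if_pos h, if_pos fun r hr => (h r hr).symm]
    have : R y = R x := by
      rw [← hR x (y t)]
      congr 1
      funext r
      by_cases hr : r = t
      · subst hr; simp
      · simp [hr, h r hr]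
    rw [this]
  · rw [if_neg h, if_neg fun h' => h fun r hr => (h' r hr).symm, star_zero]

theorem onQubits_mux (f : K ↪ Q) (t : K) (R : (K → Fin 2) → Matrix (Fin 2) (Fin 2) ℂ) :
    onQubits f (mux t R) = mux (f t) fun x => R (x ∘ f) := by
  ext x y
  by_cases h : ∀ q, q ∉ Set.range f → x q = y q
  · rw [onQubits_apply_of_agree f _ h]
    simp only [mux, Matrix.of_apply]
    refine if_congr ⟨fun h' r hr => ?_, fun h' r hr => h' _ fun e => hr (f.injective e)⟩ rfl rfl
    by_cases hq : r ∈ Set.range f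
    · obtain ⟨k, rfl⟩ := hq
      exact h' k fun e => hr (congrArg f e)
    · exact h r hq
  · rw [onQubits_apply_of_not_agree f _ h, mux, Matrix.of_apply, if_neg]
    exact fun h' => h fun q hq => h' q fun e => hq ⟨t, e.symm⟩

/-- The bit flip. -/
def notMatrix : Matrix (Fin 2) (Fin 2) ℂ := !![0, 1; 1, 0]

theorem notMatrix_mul_self : notMatrix * notMatrix = 1 := by
  simp [notMatrix, Matrix.one_fin_two]

theorem notMatrix_conjTranspose : notMatrix.conjTranspose = notMatrix := by
  ext i j; fin_cases i <;> fin_cases j <;> simp [notMatrix]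

/-- This makes every gate a multiplexed operator, so inverses, unitarity and relabelling of gates
reduce to the rules for `mux`. -/
theorem cnotMatrix_eq_mux {c t : Q} (h : c ≠ t) :
    cnotMatrix c t = mux t fun x => if x c = 1 then notMatrix else 1 := by
  ext x y
  simp only [cnotMatrix, mux, Matrix.of_apply]
  by_cases hxy : ∀ r, r ≠ t → x r = y r
  · rw [if_pos hxy]
    have : x = Function.update y t (y t + y c) ↔ x t = y t + x c := by
      rw [hxy c h]
      constructor
      · intro e; rw [e]; simp
      · intro e; funext r
        by_cases hr : r = t
        · subst hr; simpa using e
        · simp [hr, hxy r hr]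
    simp only [this]
    generalize x t = a
    generalize y t = b
    generalize x c = d
    fin_cases a <;> fin_cases b <;> fin_cases d <;> simp [notMatrix]
  · rw [if_neg hxy, if_neg]
    rintro e
    refine hxy fun r hr => ?_
    rw [e, Function.update_of_ne hr]

end Mux

/-! ### Circuits -/

section Circuit

variable {K Q : Type} [Fintype K] [DecidableEq K] [Fintype Q] [DecidableEq Q]

theorem circuitMatrix_append (C D : List (Gate Q)) :
    circuitMatrix (C ++ D) = circuitMatrix D * circuitMatrix C := by
  induction C with
  | nil => simp [circuitMatrix]
  | cons g C ih => simp [circuitMatrix, ih, mul_assoc]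

theorem circuitMatrix_singleton (g : Gate Q) : circuitMatrix [g] = g.matrix := by
  simp [circuitMatrix]

theorem rotXMatrix_conjTranspose (θ : ℝ) : (rotXMatrix θ).conjTranspose = rotXMatrix (-θ) := by
  ext i j
  fin_cases i <;> fin_cases j <;>
    simp [rotXMatrix, neg_div, -Complex.ofReal_cos, -Complex.ofReal_sin, -Complex.ofReal_div]

theorem rotYMatrix_conjTranspose (θ : ℝ) : (rotYMatrix θ).conjTranspose = rotYMatrix (-θ) := by
  ext i j
  fin_cases i <;> fin_cases j <;>
    simp [rotYMatrix, neg_div, -Complex.ofReal_cos, -Complex.ofReal_sin, -Complex.ofReal_div]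

theorem rotZMatrix_conjTranspose (θ : ℝ) : (rotZMatrix θ).conjTranspose = rotZMatrix (-θ) := by
  ext i j
  fin_cases i <;> fin_cases j <;>
    simp [rotZMatrix, neg_div, ← Complex.exp_conj, Complex.conj_ofNat]

theorem rotXMatrix_mul (θ φ : ℝ) : rotXMatrix θ * rotXMatrix φ = rotXMatrix (θ + φ) := by
  ext i j
  fin_cases i <;> fin_cases j <;>
    simp [rotXMatrix, Matrix.mul_apply, Fin.sum_univ_two, add_div, Complex.cos_add, Complex.sin_add] <;>
    ring_nf <;> simp only [Complex.I_sq] <;> ring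

theorem rotYMatrix_mul (θ φ : ℝ) : rotYMatrix θ * rotYMatrix φ = rotYMatrix (θ + φ) := by
  ext i j
  fin_cases i <;> fin_cases j <;>
    simp [rotYMatrix, Matrix.mul_apply, Fin.sum_univ_two, add_div, Complex.cos_add, Complex.sin_add] <;>
    ring

theorem rotZMatrix_mul (θ φ : ℝ) : rotZMatrix θ * rotZMatrix φ = rotZMatrix (θ + φ) := by
  ext i j
  fin_cases i <;> fin_cases j <;>
    simp [rotZMatrix, Matrix.mul_apply, Fin.sum_univ_two, ← Complex.exp_add] <;>
    ring_nf

theorem rotXMatrix_zero : rotXMatrix 0 = 1 := by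
  simp [rotXMatrix, Matrix.one_fin_two]

theorem rotYMatrix_zero : rotYMatrix 0 = 1 := by
  simp [rotYMatrix, Matrix.one_fin_two]

theorem rotZMatrix_zero : rotZMatrix 0 = 1 := by
  simp [rotZMatrix, Matrix.one_fin_two]

/-- `X` anticommutes with `Y` and with `Z`, so conjugation by it reverses the angle. -/
theorem notMatrix_conj_rotYMatrix (θ : ℝ) :
    notMatrix * rotYMatrix θ * notMatrix = rotYMatrix (-θ) := by
  simp [rotYMatrix, notMatrix, neg_div]

theorem notMatrix_conj_rotZMatrix (θ : ℝ) :
    notMatrix * rotZMatrix θ * notMatrix = rotZMatrix (-θ) := by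
  simp [rotZMatrix, notMatrix, neg_div]

/-- The inverse gate. -/
def Gate.inv : Gate Q → Gate Q
  | .rotX θ q => .rotX (-θ) q
  | .rotY θ q => .rotY (-θ) q
  | .rotZ θ q => .rotZ (-θ) q
  | .cnot c t h => .cnot c t h

/-- The gate with its qubits relabelled along an embedding. -/
def Gate.map (f : K ↪ Q) : Gate K → Gate Q
  | .rotX θ q => .rotX θ (f q)
  | .rotY θ q => .rotY θ (f q)
  | .rotZ θ q => .rotZ θ (f q)
  | .cnot c t h => .cnot (f c) (f t) (f.injective.ne h)

theorem Gate.matrix_inv (g : Gate Q) : g.inv.matrix = g.matrix.conjTranspose := by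
  cases g with
  | rotX θ q =>
    simp only [Gate.inv, Gate.matrix, onQubit_eq_mux]
    rw [mux_conjTranspose _ _ fun _ _ => rfl, rotXMatrix_conjTranspose]
  | rotY θ q =>
    simp only [Gate.inv, Gate.matrix, onQubit_eq_mux]
    rw [mux_conjTranspose _ _ fun _ _ => rfl, rotYMatrix_conjTranspose]
  | rotZ θ q =>
    simp only [Gate.inv, Gate.matrix, onQubit_eq_mux]
    rw [mux_conjTranspose _ _ fun _ _ => rfl, rotZMatrix_conjTranspose]
  | cnot c t h =>
    simp only [Gate.inv, Gate.matrix]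
    rw [cnotMatrix_eq_mux h, mux_conjTranspose _ _ fun x b => by rw [Function.update_of_ne h]]
    congr 1
    funext x
    split_ifs
    · rw [notMatrix_conjTranspose]
    · simp

theorem Gate.matrix_mul_conjTranspose (g : Gate Q) : g.matrix * g.matrix.conjTranspose = 1 := by
  rw [← Gate.matrix_inv]
  cases g with
  | rotX θ q =>
    simp only [Gate.inv, Gate.matrix, onQubit_eq_mux]
    rw [mux_mul_mux _ _ _ fun _ _ => rfl, rotXMatrix_mul, add_neg_cancel, rotXMatrix_zero, mux_one]
  | rotY θ q =>
    simp only [Gate.inv, Gate.matrix, onQubit_eq_mux]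
    rw [mux_mul_mux _ _ _ fun _ _ => rfl, rotYMatrix_mul, add_neg_cancel, rotYMatrix_zero, mux_one]
  | rotZ θ q =>
    simp only [Gate.inv, Gate.matrix, onQubit_eq_mux]
    rw [mux_mul_mux _ _ _ fun _ _ => rfl, rotZMatrix_mul, add_neg_cancel, rotZMatrix_zero, mux_one]
  | cnot c t h =>
    simp only [Gate.inv, Gate.matrix]
    rw [cnotMatrix_eq_mux h, mux_mul_mux _ _ _ fun x b => by rw [Function.update_of_ne h],
      ← mux_one t]
    congr 1
    funext x
    split_ifs
    · rw [notMatrix_mul_self]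
    · simp

theorem Gate.matrix_map (f : K ↪ Q) (g : Gate K) : (g.map f).matrix = onQubits f g.matrix := by
  cases g with
  | cnot c t h =>
    simp only [Gate.map, Gate.matrix]
    rw [cnotMatrix_eq_mux h, cnotMatrix_eq_mux (f.injective.ne h), onQubits_mux]
    rfl
  | _ => simp only [Gate.map, Gate.matrix, onQubit_eq_mux, onQubits_mux]

theorem circuitMatrix_map (f : K ↪ Q) (C : List (Gate K)) :
    circuitMatrix (C.map (Gate.map f)) = onQubits f (circuitMatrix C) := by
  induction C with
  | nil => simp [circuitMatrix, onQubits_one]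
  | cons g C ih => simp [circuitMatrix, ih, onQubits_mul, Gate.matrix_map]

/-- The inverse circuit. -/
def invCircuit (C : List (Gate Q)) : List (Gate Q) := (C.map Gate.inv).reverse

theorem length_invCircuit (C : List (Gate Q)) : (invCircuit C).length = C.length := by
  simp [invCircuit]

theorem circuitMatrix_invCircuit (C : List (Gate Q)) :
    circuitMatrix (invCircuit C) = (circuitMatrix C).conjTranspose := by
  induction C with
  | nil => simp [circuitMatrix, invCircuit]
  | cons g C ih =>
    rw [invCircuit, List.map_cons, List.reverse_cons, circuitMatrix_append, ← invCircuit, ih,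
      circuitMatrix_singleton, Gate.matrix_inv, circuitMatrix, Matrix.conjTranspose_mul]

theorem circuitMatrix_mul_conjTranspose (C : List (Gate Q)) :
    circuitMatrix C * (circuitMatrix C).conjTranspose = 1 := by
  induction C with
  | nil => simp [circuitMatrix]
  | cons g C ih =>
    rw [circuitMatrix, Matrix.conjTranspose_mul, mul_assoc, ← mul_assoc g.matrix,
      Gate.matrix_mul_conjTranspose, one_mul, ih]

theorem circuitMatrix_conjTranspose_mul (C : List (Gate Q)) :
    (circuitMatrix C).conjTranspose * circuitMatrix C = 1 :=
  mul_eq_one_comm.1 (circuitMatrix_mul_conjTranspose C)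

/-- The conjugation of a multiplexed operator by a controlled-not. -/
theorem cnotMatrix_conj_mux {c t : Q} (h : c ≠ t) (R : (Q → Fin 2) → Matrix (Fin 2) (Fin 2) ℂ)
    (hR : ∀ x b, R (Function.update x t b) = R x) :
    cnotMatrix c t * mux t R * cnotMatrix c t =
      mux t fun x => if x c = 1 then notMatrix * R x * notMatrix else R x := by
  have hN : ∀ (x : Q → Fin 2) (b : Fin 2), (if Function.update x t b c = 1 then notMatrix else 1) =
      if x c = 1 then notMatrix else 1 := fun x b => by rw [Function.update_of_ne h]
  rw [cnotMatrix_eq_mux h, mux_mul_mux _ _ _ hR, mux_mul_mux _ _ _ hN]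
  congr 1
  funext x
  split_ifs <;> simp

/-- Uniformly controlled rotations: a rotation about an axis that is reversed by the bit flip, with
an angle that depends on the qubits of `D`, takes fewer than `3 * 2 ^ #D` gates. -/
theorem exists_circuit_mux (R : ℝ → Matrix (Fin 2) (Fin 2) ℂ)
    (hadd : ∀ θ φ, R θ * R φ = R (θ + φ)) (hnot : ∀ θ, notMatrix * R θ * notMatrix = R (-θ))
    (t : Q) (hgate : ∀ θ, ∃ g : Gate Q, g.matrix = onQubit t (R θ))
    (D : Finset Q) (ht : t ∉ D) (θ : (Q → Fin 2) → ℝ)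
    (hθ : ∀ x y, (∀ q ∈ D, x q = y q) → θ x = θ y) :
    ∃ C : List (Gate Q), circuitMatrix C = mux t (fun x => R (θ x)) ∧
      C.length + 2 ≤ 3 * 2 ^ D.card := by
  induction D using Finset.induction_on generalizing θ with
  | empty =>
    obtain ⟨g, hg⟩ := hgate (θ 0)
    refine ⟨[g], ?_, by simp⟩
    rw [circuitMatrix_singleton, hg, onQubit_eq_mux]
    congr 1
    funext x
    rw [hθ x 0 (by simp)]
  | insert d D hd ih =>
    have htd : d ≠ t := fun e => ht (by simp [e])
    have htD : t ∉ D := fun e => ht (by simp [e])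
    have hup : ∀ (b : Fin 2) (x y : Q → Fin 2), (∀ q ∈ D, x q = y q) →
        θ (Function.update x d b) = θ (Function.update y d b) := by
      intro b x y hxy
      refine hθ _ _ fun q hq => ?_
      by_cases hqd : q = d
      · subst hqd; simp
      · simpa [hqd] using hxy q (Finset.mem_of_mem_insert_of_ne hq hqd)
    -- Half-sum and half-difference of the angles for the two values of `d`. The pair of
    -- controlled-nots reverses `β` exactly when `d` is `1`, so the total angle is `α + β` or `α -
    -- β`, as required.
    let α : (Q → Fin 2) → ℝ := fun x =>
      (θ (Function.update x d 0) + θ (Function.update x d 1)) / 2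
    let β : (Q → Fin 2) → ℝ := fun x =>
      (θ (Function.update x d 0) - θ (Function.update x d 1)) / 2
    have hα : ∀ x y, (∀ q ∈ D, x q = y q) → α x = α y := fun x y h => by
      simp only [α, hup _ x y h]
    have hβ : ∀ x y, (∀ q ∈ D, x q = y q) → β x = β y := fun x y h => by
      simp only [β, hup _ x y h]
    obtain ⟨A, hA, hAl⟩ := ih htD α hα
    obtain ⟨B, hB, hBl⟩ := ih htD β hβ
    refine ⟨A ++ ([.cnot d t htd] ++ (B ++ [.cnot d t htd])), ?_, ?_⟩
    · have hind : ∀ (γ : (Q → Fin 2) → ℝ), (∀ x y, (∀ q ∈ D, x q = y q) → γ x = γ y) →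
          ∀ x b, R (γ (Function.update x t b)) = R (γ x) := fun γ hγ x b => by
        rw [hγ _ x fun q hq => Function.update_of_ne (ne_of_mem_of_not_mem hq htD) _ _]
      simp only [circuitMatrix_append, circuitMatrix_singleton, hA, hB, Gate.matrix]
      rw [cnotMatrix_conj_mux htd _ (hind β hβ), mux_mul_mux _ _ _ (hind α hα)]
      congr 1
      funext x
      by_cases hx : x d = 1
      · rw [if_pos hx, hnot, hadd]
        congr 1
        have : Function.update x d 1 = x := by rw [← hx, Function.update_eq_self]
        simp only [α, β, this]
        ring
      · have hx0 : x d = 0 := by omega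
        rw [if_neg hx, hadd]
        congr 1
        have : Function.update x d 0 = x := by rw [← hx0, Function.update_eq_self]
        simp only [α, β, this]
        ring
    -- The length obeys `L ↦ 2L + 2`, so `L + 2` doubles, starting from `3` for a single gate.
    · rw [Finset.card_insert_of_notMem hd, pow_succ]
      simp only [List.length_append, List.length_singleton]
      omega

theorem exists_circuit_muxY (t : Q) (D : Finset Q) (ht : t ∉ D) (θ : (Q → Fin 2) → ℝ)
    (hθ : ∀ x y, (∀ q ∈ D, x q = y q) → θ x = θ y) :
    ∃ C : List (Gate Q), circuitMatrix C = mux t (fun x => rotYMatrix (θ x)) ∧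
      C.length ≤ 3 * 2 ^ D.card := by
  obtain ⟨C, hC, hl⟩ := exists_circuit_mux rotYMatrix rotYMatrix_mul notMatrix_conj_rotYMatrix t
    (fun θ => ⟨.rotY θ t, rfl⟩) D ht θ hθ
  exact ⟨C, hC, by omega⟩

theorem exists_circuit_muxZ (t : Q) (D : Finset Q) (ht : t ∉ D) (θ : (Q → Fin 2) → ℝ)
    (hθ : ∀ x y, (∀ q ∈ D, x q = y q) → θ x = θ y) :
    ∃ C : List (Gate Q), circuitMatrix C = mux t (fun x => rotZMatrix (θ x)) ∧
      C.length ≤ 3 * 2 ^ D.card := by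
  obtain ⟨C, hC, hl⟩ := exists_circuit_mux rotZMatrix rotZMatrix_mul notMatrix_conj_rotZMatrix t
    (fun θ => ⟨.rotZ θ t, rfl⟩) D ht θ hθ
  exact ⟨C, hC, by omega⟩

end Circuit

/-! ### State preparation -/

section Prepare

variable {Q : Type} [Fintype Q] [DecidableEq Q]

/-- Every vector of a qubit is a multiple of `rotZMatrix φ * rotYMatrix θ` applied to `|0⟩`. -/
theorem exists_rotZ_mul_rotY (a : Fin 2 → ℂ) : ∃ (r : ℂ) (θ φ : ℝ),
    (∀ i, a i = (rotZMatrix φ * rotYMatrix θ) i 0 * r) ∧ (a = 0 → r = 0) := by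
  -- The norm of `z` is that of `a`, and its argument is half the `Y` angle. The `Z` angle is the
  -- difference of the phases of `a 0` and `a 1`; the scalar carries their mean.
  let z : ℂ := ⟨‖a 0‖, ‖a 1‖⟩
  refine ⟨‖z‖ * Complex.exp (((a 0).arg + (a 1).arg) / 2 * Complex.I), 2 * z.arg,
    (a 1).arg - (a 0).arg, ?_, ?_⟩
  · have h0 : (‖a 0‖ : ℂ) = ‖z‖ * Complex.cos z.arg := by
      rw [← Complex.ofReal_cos, ← Complex.ofReal_mul, Complex.norm_mul_cos_arg]
    have h1 : (‖a 1‖ : ℂ) = ‖z‖ * Complex.sin z.arg := by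
      rw [← Complex.ofReal_sin, ← Complex.ofReal_mul, Complex.norm_mul_sin_arg]
    intro i
    fin_cases i
    · have e : Complex.exp ((a 0).arg * Complex.I) =
          Complex.exp (-(Complex.I * (((a 1).arg - (a 0).arg) / 2))) *
            Complex.exp (((a 0).arg + (a 1).arg) / 2 * Complex.I) := by
        rw [← Complex.exp_add]; ring_nf
      have := Complex.norm_mul_exp_arg_mul_I (a 0)
      rw [h0, e] at this
      simp only [rotZMatrix, rotYMatrix, Matrix.mul_apply, Fin.sum_univ_two]
      simp
      linear_combination -this
    · have e : Complex.exp ((a 1).arg * Complex.I) =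
          Complex.exp (Complex.I * (((a 1).arg - (a 0).arg) / 2)) *
            Complex.exp (((a 0).arg + (a 1).arg) / 2 * Complex.I) := by
        rw [← Complex.exp_add]; ring_nf
      have := Complex.norm_mul_exp_arg_mul_I (a 1)
      rw [h1, e] at this
      simp only [rotZMatrix, rotYMatrix, Matrix.mul_apply, Fin.sum_univ_two]
      simp
      linear_combination -this
  · rintro rfl
    have : z = 0 := Complex.ext (by simp [z]) (by simp [z])
    simp [this]

/-- Up to a scalar, every vector supported on the states of the qubits of `D` is prepared from
`|0⟩` by a circuit of `O(2 ^ #D)` gates. -/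
theorem exists_circuit_prepare (D : Finset Q) (v : (Q → Fin 2) → ℂ)
    (hv : ∀ x, (∃ q, q ∉ D ∧ x q ≠ 0) → v x = 0) :
    ∃ (C : List (Gate Q)) (c : ℂ), v = c • (circuitMatrix C).mulVec (Pi.single 0 1) ∧
      C.length ≤ 6 * 2 ^ D.card := by
  induction D using Finset.induction_on generalizing v with
  | empty =>
    refine ⟨[], v 0, ?_, by simp⟩
    funext x
    by_cases hx : x = 0
    · simp [hx, circuitMatrix]
    · rw [hv x (by simpa [funext_iff] using hx)]
      simp [circuitMatrix, hx]
  | insert d D hd ih =>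
    choose r θ φ hr hr0 using fun x : Q → Fin 2 =>
      exists_rotZ_mul_rotY fun b => v (Function.update x d b)
    -- The chosen angles may depend on all bits, while the multiplexers see only those of `D`.
    -- Zeroing the other bits loses nothing, since off the support of `v` the amplitude `r` vanishes
    -- anyway.
    let restrict : (Q → Fin 2) → Q → Fin 2 := fun x q => if q ∈ D then x q else 0
    have hres : ∀ x y : Q → Fin 2, (∀ q ∈ D, x q = y q) → restrict x = restrict y :=
      fun x y h => funext fun q => by
        by_cases hq : q ∈ D
        · simp [restrict, hq, h q hq]
        · simp [restrict, hq]
    -- The vector left after rotating `d` back to `|0⟩`; the induction hypothesis prepares it.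
    let u : (Q → Fin 2) → ℂ := fun x => if x d = 0 then r x else 0
    have hru : ∀ x, (∃ q, q ∉ insert d D ∧ x q ≠ 0) → r x = 0 := by
      rintro x ⟨q, hq, hxq⟩
      refine hr0 x (funext fun b => hv _ ⟨q, hq, ?_⟩)
      rwa [Function.update_of_ne]
      exact fun e => hq (by simp [e])
    obtain ⟨C, c, hC, hl⟩ := ih u (by
      rintro x ⟨q, hq, hxq⟩
      simp only [u]
      split_ifs with hx
      · refine hru x ⟨q, ?_, hxq⟩
        rw [Finset.mem_insert, not_or]
        exact ⟨fun e => hxq (e ▸ hx), hq⟩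
      · rfl)
    obtain ⟨CY, hY, hYl⟩ := exists_circuit_muxY d D hd (fun x => θ (restrict x))
      fun x y h => by rw [hres x y h]
    obtain ⟨CZ, hZ, hZl⟩ := exists_circuit_muxZ d D hd (fun x => φ (restrict x))
      fun x y h => by rw [hres x y h]
    refine ⟨C ++ (CY ++ CZ), c, ?_, ?_⟩
    · rw [circuitMatrix_append, circuitMatrix_append, ← Matrix.mulVec_mulVec, ← Matrix.mulVec_smul,
        ← hC, hY, hZ, mux_mul_mux]
      · funext x
        rw [mux_mulVec_apply, Fin.sum_univ_two]
        have h0 : u (Function.update x d 0) = r (Function.update x d 0) := by simp [u]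
        have h1 : u (Function.update x d 1) = 0 := by simp [u]
        rw [h0, h1, mul_zero, add_zero]
        by_cases hx : ∃ q, q ∉ insert d D ∧ x q ≠ 0
        · obtain ⟨q, hq, hxq⟩ := hx
          rw [hv x ⟨q, hq, hxq⟩, hru, mul_zero]
          refine ⟨q, hq, ?_⟩
          rwa [Function.update_of_ne]
          exact fun e => hq (by simp [e])
        · have hrx : restrict x = Function.update x d 0 := by
            push Not at hx
            funext q
            by_cases hqd : q = d
            · subst hqd; simp [restrict, hd]
            · by_cases hqD : q ∈ D
              · simp [restrict, hqD, hqd]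
              · simp [restrict, hqD, hqd, hx q (by simp [hqD, hqd])]
          rw [hrx, ← hr (Function.update x d 0) (x d)]
          simp
      · intro x b
        rw [hres _ x fun q hq => Function.update_of_ne (ne_of_mem_of_not_mem hq hd) _ _]
    -- The two multiplexers cost at most `6 * 2 ^ #D`, which is the increment from `6 * 2 ^ #D` to
    -- its double.
    · rw [Finset.card_insert_of_notMem hd, pow_succ]
      simp only [List.length_append]
      omega

theorem dotProduct_star_mulVec_of_conjTranspose_mul {ι : Type*} [Fintype ι] [DecidableEq ι]
    {M : Matrix ι ι ℂ} (hM : M.conjTranspose * M = 1) (v : ι → ℂ) :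
    star (M.mulVec v) ⬝ᵥ M.mulVec v = star v ⬝ᵥ v := by
  rw [Matrix.star_mulVec, ← Matrix.dotProduct_mulVec, Matrix.mulVec_mulVec, hM, Matrix.one_mulVec]

/-- Up to a phase, every unit vector is prepared from `|0⟩` by a circuit of `O(2 ^ card Q)` gates. -/
theorem exists_circuit_prepare_unit (v : (Q → Fin 2) → ℂ) (hv : star v ⬝ᵥ v = 1) :
    ∃ (C : List (Gate Q)) (c : ℂ), v = c • (circuitMatrix C).mulVec (Pi.single 0 1) ∧
      star c * c = 1 ∧ C.length ≤ 6 * 2 ^ Fintype.card Q := by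
  obtain ⟨C, c, hC, hl⟩ := exists_circuit_prepare Finset.univ v (by simp)
  refine ⟨C, c, hC, ?_, hl⟩
  rw [hC, star_smul, smul_dotProduct, dotProduct_smul, dotProduct_star_mulVec_of_conjTranspose_mul
    (circuitMatrix_conjTranspose_mul C)] at hv
  simpa using hv

end Prepare

/-! ### Work qubits -/

section WithWork

variable {K Q W : Type} [Fintype K] [DecidableEq K] [Fintype Q] [DecidableEq Q]
  [Fintype W] [DecidableEq W]

/-- The isometry `|y⟩ ↦ |y⟩ ⊗ |a⟩`. -/
def withWork (Q : Type) [Fintype Q] [DecidableEq Q] (a : W → Fin 2) :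
    Matrix (Q ⊕ W → Fin 2) (Q → Fin 2) ℂ :=
  Matrix.of fun x y => if x = Sum.elim y a then 1 else 0

theorem mul_withWork_apply {ι : Type*} (M : Matrix ι (Q ⊕ W → Fin 2) ℂ) (a : W → Fin 2) (i : ι)
    (y : Q → Fin 2) : (M * withWork Q a) i y = M i (Sum.elim y a) := by
  simp [Matrix.mul_apply, withWork]

theorem elim_eq_elim_iff {x y : Q → Fin 2} {z a : W → Fin 2} :
    Sum.elim x z = Sum.elim y a ↔ x = y ∧ z = a :=
  Sum.elim_eq_iff

theorem withWork_mul_apply {ι : Type*} (U : Matrix (Q → Fin 2) ι ℂ) (a z : W → Fin 2)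
    (x : Q → Fin 2) (i : ι) :
    (withWork Q a * U) (Sum.elim x z) i = if z = a then U x i else 0 := by
  simp only [Matrix.mul_apply, withWork, Matrix.of_apply, elim_eq_elim_iff]
  by_cases h : z = a <;> simp [h]

theorem ext_withWork {ι : Type*} {M N : Matrix (Q ⊕ W → Fin 2) ι ℂ}
    (h : ∀ x z i, M (Sum.elim x z) i = N (Sum.elim x z) i) : M = N := by
  ext x i
  rw [← Sum.elim_comp_inl_inr x]
  exact h _ _ _

/-- In this form circuits compose by moving the isometry through the factors one at a time. -/
theorem implements_iff {C : List (Gate (Q ⊕ W))} {U : Op Q} :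
    Implements C U ↔ circuitMatrix C * withWork Q (0 : W → Fin 2) = withWork Q (0 : W → Fin 2) * U := by
  constructor
  · intro h
    refine ext_withWork fun x z y => ?_
    rw [mul_withWork_apply, withWork_mul_apply]
    exact h x y z
  · intro h x y z
    rw [← withWork_mul_apply, ← h, mul_withWork_apply]
    rfl

theorem withWork_conjTranspose_mul (a b : W → Fin 2) :
    (withWork Q a).conjTranspose * withWork Q b = if a = b then 1 else 0 := by
  ext x y
  rw [mul_withWork_apply, Matrix.conjTranspose_apply, withWork, Matrix.of_apply]
  simp only [elim_eq_elim_iff]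
  by_cases h : a = b <;> by_cases h' : x = y <;> simp_all [Matrix.one_apply, eq_comm]

/-- An operator implemented by a circuit is unitary. -/
theorem mem_unitaryGroup_of_circuitMatrix_mul {C : List (Gate (Q ⊕ W))} {U : Op Q}
    {a : W → Fin 2} (h : circuitMatrix C * withWork Q a = withWork Q a * U) :
    U ∈ Matrix.unitaryGroup (Q → Fin 2) ℂ := by
  have h1 : (withWork Q a * U).conjTranspose * (withWork Q a * U) = 1 := by
    rw [← h, Matrix.conjTranspose_mul, Matrix.mul_assoc, ← Matrix.mul_assoc _ (circuitMatrix C),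
      circuitMatrix_conjTranspose_mul, Matrix.one_mul, withWork_conjTranspose_mul, if_pos rfl]
  rw [Matrix.conjTranspose_mul, Matrix.mul_assoc, ← Matrix.mul_assoc _ _ U,
    withWork_conjTranspose_mul, if_pos rfl, Matrix.one_mul] at h1
  exact Matrix.mem_unitaryGroup_iff'.2 h1

/-- The embedding of the qubits `K` of `Q` into `Q ⊕ W`. -/
def intoSystem (W : Type) (f : K ↪ Q) : K ↪ Q ⊕ W := f.trans Function.Embedding.inl

theorem onQubits_intoSystem_mul_withWork (f : K ↪ Q) (M : Op K) (a : W → Fin 2) :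
    onQubits (intoSystem W f) M * withWork Q a = withWork Q a * onQubits f M := by
  refine ext_withWork fun x z y => ?_
  rw [mul_withWork_apply, withWork_mul_apply]
  by_cases h : (∀ q, q ∉ Set.range f → x q = y q) ∧ z = a
  · rw [if_pos h.2, onQubits_apply_of_agree f _ h.1, onQubits_apply_of_agree]
    · rfl
    · rintro (q | q) hq
      · exact h.1 q fun ⟨k, hk⟩ => hq ⟨k, congrArg Sum.inl hk⟩
      · exact congrFun h.2 q
  · rw [onQubits_apply_of_not_agree]
    · split_ifs with hz
      · rw [onQubits_apply_of_not_agree]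
        exact fun h' => h ⟨h', hz⟩
      · rfl
    · intro h'
      refine h ⟨fun q hq => h' (Sum.inl q) ?_, funext fun q => h' (Sum.inr q) ?_⟩
      · rintro ⟨k, hk⟩
        exact hq ⟨k, Sum.inl_injective hk⟩
      · rintro ⟨k, hk⟩
        exact Sum.inl_ne_inr hk

/-- A system target leaves the work state `a` unchanged, so work qubits among the controls become
constants. -/
theorem mux_inl_mul_withWork (t : Q) (R : (Q ⊕ W → Fin 2) → Matrix (Fin 2) (Fin 2) ℂ)
    (a : W → Fin 2) :
    mux (Sum.inl t) R * withWork Q a = withWork Q a * mux t fun x => R (Sum.elim x a) := by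
  refine ext_withWork fun x z y => ?_
  rw [mul_withWork_apply, withWork_mul_apply]
  simp only [mux, Matrix.of_apply, Sum.forall, Sum.elim_inl, Sum.elim_inr, ne_eq, Sum.inl.injEq,
    reduceCtorEq, not_false_eq_true, forall_true_left]
  by_cases hz : z = a
  · simp [hz]
  · rw [if_neg hz]
    exact if_neg fun h => hz (funext h.2)

/-- With a work qubit as target, the system is only a control: it is acted on diagonally, and the
work state branches over the new values of the bit `t`. -/
theorem mux_inr_mul_withWork (t : W) (R : (Q ⊕ W → Fin 2) → Matrix (Fin 2) (Fin 2) ℂ)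
    (hR : ∀ x b, R (Function.update x (Sum.inr t) b) = R x) (a : W → Fin 2) :
    mux (Sum.inr t) R * withWork Q a = ∑ b, withWork Q (Function.update a t b) *
      Matrix.diagonal fun x => R (Sum.elim x a) b (a t) := by
  refine ext_withWork fun x z y => ?_
  rw [mul_withWork_apply, Matrix.sum_apply]
  simp only [withWork_mul_apply]
  simp only [mux, Matrix.of_apply, Sum.forall, Sum.elim_inl, Sum.elim_inr, ne_eq, Sum.inr.injEq,
    reduceCtorEq, not_false_eq_true, forall_true_left, Matrix.diagonal_apply]
  by_cases hz : ∀ r, r ≠ t → z r = a r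
  · have hz' : ∀ b, z = Function.update a t b ↔ z t = b := fun b => by
      constructor
      · rintro rfl; simp
      · rintro rfl
        funext r
        by_cases hr : r = t
        · subst hr; simp
        · simp [hr, hz r hr]
    have hRz : R (Sum.elim x z) = R (Sum.elim x a) := by
      rw [← hR (Sum.elim x a) (z t)]
      congr 1
      funext r
      rcases r with r | r
      · simp
      · rw [Sum.elim_inr, ← Sum.elim_update_right, Sum.elim_inr, ← (hz' (z t)).2 rfl]
    simp only [hz', hRz]
    by_cases hxy : x = y
    · rw [if_pos ⟨fun r => by rw [hxy], hz⟩]; simp [hxy]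
    · rw [if_neg fun h => hxy (funext h.1)]; simp [hxy]
  · refine (if_neg fun h => hz h.2).trans (Eq.symm ?_)
    refine Finset.sum_eq_zero fun b _ => if_neg ?_
    rintro rfl
    exact hz fun r hr => Function.update_of_ne hr _ _

end WithWork

/-! ### The dilation of a contraction -/

section DilationCircuit

variable {K Q W : Type} [Fintype K] [DecidableEq K] [Fintype Q] [DecidableEq Q]
  [Fintype W] [DecidableEq W]

/-- The projection `|v⟩⟨v|` for a unit vector `v`. -/
def rankOne (v : (K → Fin 2) → ℂ) : Op K := Matrix.vecMulVec v (star v)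

theorem dilation_apply (w : Op K) (x y : K ⊕ Unit → Fin 2) :
    dilation w x y = !![w (x ∘ Sum.inl) (y ∘ Sum.inl),
        -CFC.sqrt (1 - w * w) (x ∘ Sum.inl) (y ∘ Sum.inl);
      CFC.sqrt (1 - w * w) (x ∘ Sum.inl) (y ∘ Sum.inl), w (x ∘ Sum.inl) (y ∘ Sum.inl)]
        (x (Sum.inr ())) (y (Sum.inr ())) := by
  have hx : x (Sum.inr ()) = 0 ∨ x (Sum.inr ()) = 1 := by omega
  have hy : y (Sum.inr ()) = 0 ∨ y (Sum.inr ()) = 1 := by omega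
  rcases hx with hx | hx <;> rcases hy with hy | hy <;> simp [dilation, hx, hy]

/-- In an eigenbasis of `h` the dilation of `1 - h` is a rotation of the ancilla for each
eigenvector. -/
theorem exists_dilation_eq (h : Op K) (hh : h.PosSemidef) (hn : ‖h‖ ≤ 2) :
    ∃ (v : (K → Fin 2) → (K → Fin 2) → ℂ) (θ : (K → Fin 2) → ℝ),
      (∀ i j, star (v i) ⬝ᵥ v j = if i = j then 1 else 0) ∧
      (∑ i, rankOne (v i) = 1) ∧
      ∀ x y, dilation (1 - h) x y = ∑ i, rankOne (v i) (x ∘ Sum.inl) (y ∘ Sum.inl) *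
        rotYMatrix (θ i) (x (Sum.inr ())) (y (Sum.inr ())) := by
  let U : Op K := hh.1.eigenvectorUnitary
  have hU : U * U.conjTranspose = 1 :=
    Matrix.mem_unitaryGroup_iff.1 hh.1.eigenvectorUnitary.2
  have hU' : U.conjTranspose * U = 1 := mul_eq_one_comm.1 hU
  let ev := hh.1.eigenvalues
  have hev0 : ∀ i, 0 ≤ ev i := hh.eigenvalues_nonneg
  have hev2 : ∀ i, ev i ≤ 2 := fun i => by
    have := spectrum.norm_le_norm_of_mem (hh.1.eigenvalues_mem_spectrum_real i)
    exact (le_abs_self _).trans (this.trans hn)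
  -- The eigenvalues lie in `[0, 2]`, so `1 - ev i` is a cosine. With half-angle in `[0, π]` its
  -- sine is nonnegative, hence is the square root taken in the dilation.
  let θ : (K → Fin 2) → ℝ := fun i => 2 * Real.arccos (1 - ev i)
  have hcos : ∀ i, Real.cos (θ i / 2) = 1 - ev i := fun i => by
    simp only [θ, mul_div_cancel_left₀ _ (two_ne_zero' ℝ)]
    exact Real.cos_arccos (by linarith [hev2 i]) (by linarith [hev0 i])
  have hsin : ∀ i, 0 ≤ Real.sin (θ i / 2) := fun i => by
    simp only [θ, mul_div_cancel_left₀ _ (two_ne_zero' ℝ)]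
    exact Real.sin_nonneg_of_nonneg_of_le_pi (Real.arccos_nonneg _) (Real.arccos_le_pi _)
  -- Functional calculus in the eigenbasis: it is multiplicative and respects differences, so the
  -- operator identities become scalar ones.
  let T : ((K → Fin 2) → ℂ) → Op K := fun d => U * Matrix.diagonal d * U.conjTranspose
  have hT : ∀ d x y, T d x y = ∑ i, rankOne (fun x => U x i) x y * d i := fun d x y => by
    simp only [T]
    rw [Matrix.mul_apply]
    simp only [Matrix.mul_diagonal, rankOne, Matrix.vecMulVec_apply, Matrix.conjTranspose_apply,
      Pi.star_apply]
    exact Finset.sum_congr rfl fun i _ => by ring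
  have hTmul : ∀ d e, T d * T e = T fun i => d i * e i := fun d e => by
    simp only [T]
    rw [mul_assoc (U * _), ← mul_assoc U.conjTranspose, ← mul_assoc U.conjTranspose, hU', one_mul,
      ← mul_assoc, mul_assoc U, Matrix.diagonal_mul_diagonal]
  have hT1 : T (fun _ => 1) = 1 := by simp only [T, Matrix.diagonal_one, mul_one, hU]
  have hTsub : ∀ d e, T d - T e = T fun i => d i - e i := fun d e => by
    simp only [T]
    rw [← sub_mul, ← mul_sub, Matrix.diagonal_sub]
  have hTh : h = T fun i => (ev i : ℂ) := by
    conv_lhs => rw [hh.1.spectral_theorem, Unitary.conjStarAlgAut_apply]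
    rfl
  have hw : 1 - h = T fun i => (Real.cos (θ i / 2) : ℂ) := by
    rw [← hT1]
    conv_lhs => rw [hTh]
    rw [hTsub]
    simp only [hcos, Complex.ofReal_sub, Complex.ofReal_one]
  have hr : CFC.sqrt (1 - (1 - h) * (1 - h)) = T fun i => (Real.sin (θ i / 2) : ℂ) := by
    refine CFC.sqrt_unique ?_ ?_
    · rw [hw, hTmul, hTmul, ← hT1, hTsub]
      congr 1
      funext i
      rw [← Complex.ofReal_mul, ← Complex.ofReal_mul, ← Complex.ofReal_one, ← Complex.ofReal_sub]
      congr 1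
      nlinarith [Real.sin_sq_add_cos_sq (θ i / 2)]
    · rw [Matrix.nonneg_iff_posSemidef]
      refine Matrix.PosSemidef.mul_mul_conjTranspose_same (Matrix.PosSemidef.diagonal fun i => ?_) U
      exact Complex.zero_le_real.2 (hsin i)
  refine ⟨fun i x => U x i, θ, fun i j => ?_, ?_, fun x y => ?_⟩
  · rw [← Matrix.one_apply, ← hU', Matrix.mul_apply]
    rfl
  · ext x y
    rw [← hT1, hT, Matrix.sum_apply]
    simp
  · rw [dilation_apply, hr, hw]
    have hx : x (Sum.inr ()) = 0 ∨ x (Sum.inr ()) = 1 := by omega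
    have hy : y (Sum.inr ()) = 0 ∨ y (Sum.inr ()) = 1 := by omega
    rcases hx with hx | hx <;> rcases hy with hy | hy <;>
      simp [-Complex.ofReal_cos, -Complex.ofReal_sin, hx, hy, rotYMatrix, hT]

theorem onQubits_mul_onQubit_apply (f : K ↪ Q) {t : Q} (ht : t ∉ Set.range f) (M : Op K)
    (R : Matrix (Fin 2) (Fin 2) ℂ) (x y : Q → Fin 2)
    (h : ∀ q, q ∉ Set.range f → q ≠ t → x q = y q) :
    (onQubits f M * onQubit t R) x y = M (x ∘ f) (y ∘ f) * R (x t) (y t) := by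
  rw [onQubits_mul_apply, Finset.sum_eq_single (y ∘ f)]
  · rw [onQubit, Matrix.of_apply, if_pos, extend_apply_notMem f _ _ ht]
    intro r hr
    by_cases hrf : r ∈ Set.range f
    · obtain ⟨k, rfl⟩ := hrf
      exact f.injective.extend_apply _ _ _
    · rw [extend_apply_notMem f _ _ hrf, h r hrf hr]
  · intro u _ hu
    rw [onQubit, Matrix.of_apply, if_neg, mul_zero]
    refine fun h' => hu (funext fun k => ?_)
    rw [Function.comp_apply, ← h' (f k) fun e => ht ⟨k, e⟩, f.injective.extend_apply]
  · simp

theorem onQubits_mul_onQubit_apply_of_ne (f : K ↪ Q) {t : Q} (M : Op K)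
    (R : Matrix (Fin 2) (Fin 2) ℂ) (x y : Q → Fin 2)
    (h : ¬∀ q, q ∉ Set.range f → q ≠ t → x q = y q) :
    (onQubits f M * onQubit t R) x y = 0 := by
  rw [onQubits_mul_apply]
  refine Finset.sum_eq_zero fun u _ => ?_
  rw [onQubit, Matrix.of_apply, if_neg, mul_zero]
  refine fun h' => h fun q hq hqt => ?_
  rw [← h' q hqt, extend_apply_notMem f _ _ hq]

theorem onQubit_mul_onQubits (f : K ↪ Q) {t : Q} (ht : t ∉ Set.range f) (M : Op K)
    (R : Matrix (Fin 2) (Fin 2) ℂ) :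
    onQubit t R * onQubits f M = onQubits f M * onQubit t R := by
  have key := onQubits_mul_onQubit_apply f ht M.conjTranspose R.conjTranspose
  have key' := onQubits_mul_onQubit_apply_of_ne f (t := t) M.conjTranspose R.conjTranspose
  -- The reversed product is the adjoint of a product in the original order, so the same entry
  -- formula computes both sides.
  have e : onQubit t R * onQubits f M =
      (onQubits f M.conjTranspose * onQubit t R.conjTranspose).conjTranspose := by
    rw [Matrix.conjTranspose_mul, ← onQubits_conjTranspose, Matrix.conjTranspose_conjTranspose,
      onQubit_eq_mux, onQubit_eq_mux, mux_conjTranspose _ _ fun _ _ => rfl,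
      Matrix.conjTranspose_conjTranspose]
  ext x y
  rw [e, Matrix.conjTranspose_apply]
  by_cases h : ∀ q, q ∉ Set.range f → q ≠ t → x q = y q
  · rw [onQubits_mul_onQubit_apply f ht _ _ _ _ h, key _ _ fun q h1 h2 => (h q h1 h2).symm]
    simp
  · rw [onQubits_mul_onQubit_apply_of_ne f _ _ _ _ h, key' _ _ fun h' => h fun q h1 h2 =>
      (h' q h1 h2).symm, star_zero]

/-- The rotation of `t` controlled by the qubits of `f` being in the state `|0⟩`. -/
theorem mux_ite_comp_eq_zero (f : K ↪ Q) {t : Q} (ht : t ∉ Set.range f)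
    (R : Matrix (Fin 2) (Fin 2) ℂ) :
    mux t (fun x => if x ∘ f = 0 then R else 1) =
      1 + onQubits f (Matrix.single 0 0 1) * (onQubit t R - 1) := by
  have h1 : (1 : Op Q) = onQubit t 1 := (mux_one t).symm
  ext x y
  rw [mul_sub, Matrix.add_apply, Matrix.sub_apply]
  conv_rhs => rw [h1]
  by_cases h : ∀ q, q ∉ Set.range f → q ≠ t → x q = y q
  · rw [onQubits_mul_onQubit_apply f ht _ _ _ _ h, onQubits_mul_onQubit_apply f ht _ _ _ _ h]
    simp only [mux, onQubit, Matrix.of_apply]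
    by_cases hx : x ∘ f = 0
    · by_cases hy : y ∘ f = 0
      · have hr : ∀ r, r ≠ t → x r = y r := by
          intro r hr
          by_cases hrf : r ∈ Set.range f
          · obtain ⟨k, rfl⟩ := hrf
            exact (congrFun hx k).trans (congrFun hy k).symm
          · exact h r hrf hr
        rw [if_pos hr, if_pos hr, if_pos hx, hx, hy]
        simp
      · have hr : ¬∀ r, r ≠ t → x r = y r := by
          intro hr
          refine hy (funext fun k => ?_)
          rw [← hx]
          exact (hr (f k) fun e => ht ⟨k, e⟩).symm
        rw [if_neg hr, if_neg hr, Matrix.single_apply_of_ne]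
        · simp
        · exact fun e => hy e.2.symm
    · rw [if_neg hx, Matrix.single_apply_of_ne]
      · simp
      · exact fun e => hx e.1.symm
  · rw [onQubits_mul_onQubit_apply_of_ne f _ _ _ _ h, onQubits_mul_onQubit_apply_of_ne f _ _ _ _ h]
    have hr : ¬∀ r, r ≠ t → x r = y r := fun hr => h fun q _ hq => hr q hq
    simp only [mux, onQubit, Matrix.of_apply]
    rw [if_neg hr, if_neg hr]
    simp

/-- The rotation of `t` controlled by the work qubit `c` and by the qubits of `f` being in the state
`|v⟩`. -/
theorem exists_circuit_controlled_rotation (f : K ↪ Q) {t : Q} (ht : t ∉ Set.range f)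
    (v : (K → Fin 2) → ℂ) (hv : star v ⬝ᵥ v = 1) (θ : ℝ) (c : W) :
    ∃ C : List (Gate (Q ⊕ W)), C.length ≤ 18 * 2 ^ Fintype.card K ∧ ∀ a,
      circuitMatrix C * withWork Q a = withWork Q a * if a c = 1 then
        1 + onQubits f (rankOne v) * (onQubit t (rotYMatrix θ) - 1) else 1 := by
  obtain ⟨P, γ, hP, hγ, hPl⟩ := exists_circuit_prepare_unit v hv
  -- The phase `γ` left open by the preparation cancels in `|v⟩⟨v|`.
  have hE : circuitMatrix P * Matrix.single 0 0 1 * (circuitMatrix P).conjTranspose = rankOne v := by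
    ext x y
    have e : ∀ z, circuitMatrix P z 0 = (circuitMatrix P).mulVec (Pi.single 0 1) z := fun z => by
      simp
    rw [rankOne, hP, Matrix.vecMulVec_apply, Pi.star_apply, Pi.smul_apply, Pi.smul_apply, ← e, ← e,
      Matrix.mul_apply, Finset.sum_eq_single 0]
    · simp only [Matrix.mul_single_apply_same, Matrix.conjTranspose_apply, smul_eq_mul, star_mul']
      linear_combination (-(circuitMatrix P x 0 * star (circuitMatrix P y 0))) * hγ
    · intro z _ hz
      rw [Matrix.mul_single_apply_of_ne _ _ _ _ _ hz, zero_mul]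
    · simp
  let φ : (Q ⊕ W → Fin 2) → ℝ := fun x =>
    if x (Sum.inr c) = 1 ∧ x ∘ (intoSystem W f) = 0 then θ else 0
  obtain ⟨R, hR, hRl⟩ := exists_circuit_muxY (Sum.inl t : Q ⊕ W)
    (insert (Sum.inr c) (Finset.univ.map (intoSystem W f)))
    (by
      simp only [Finset.mem_insert, reduceCtorEq, Finset.mem_map, Finset.mem_univ, true_and,
        false_or, not_exists]
      intro k hk
      exact ht ⟨k, Sum.inl_injective hk⟩)
    φ (fun x y h => by
      have h1 : x ∘ (intoSystem W f) = y ∘ (intoSystem W f) :=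
        funext fun k => h _ (by simp)
      simp only [φ, h (Sum.inr c) (by simp), h1])
  -- Unprepare `v`, rotate if the qubits of `f` are all `0`, prepare again. The preparation needs no
  -- control: it cancels when the rotation is off. The cost is `6 + 6 + 6` times `2 ^ card K`, as
  -- the rotation has one control more.
  refine ⟨invCircuit (P.map (Gate.map (intoSystem W f))) ++
    (R ++ P.map (Gate.map (intoSystem W f))), ?_, fun a => ?_⟩
  · have h1 := Finset.card_insert_le (Sum.inr c) (Finset.univ.map (intoSystem W f))
    rw [Finset.card_map, Finset.card_univ] at h1
    have h2 := Nat.pow_le_pow_right (n := 2) (by norm_num) h1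
    rw [pow_succ] at h2
    simp only [List.length_append, length_invCircuit, List.length_map]
    omega
  · rw [circuitMatrix_append, circuitMatrix_append, circuitMatrix_invCircuit, circuitMatrix_map,
      ← onQubits_conjTranspose, Matrix.mul_assoc, onQubits_intoSystem_mul_withWork, hR,
      Matrix.mul_assoc, ← Matrix.mul_assoc (mux _ _), mux_inl_mul_withWork, ← Matrix.mul_assoc,
      ← Matrix.mul_assoc, onQubits_intoSystem_mul_withWork, Matrix.mul_assoc, Matrix.mul_assoc]
    congr 1
    have hPP : onQubits f (circuitMatrix P) * onQubits f (circuitMatrix P).conjTranspose = 1 := by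
      rw [← onQubits_mul, circuitMatrix_mul_conjTranspose, onQubits_one]
    by_cases hc : a c = 1
    · have : mux t (fun x => rotYMatrix (φ (Sum.elim x a))) =
          mux t (fun x => if x ∘ f = 0 then rotYMatrix θ else 1) := by
        congr 1
        funext x
        have : Sum.elim x a ∘ (intoSystem W f) = x ∘ f := rfl
        simp only [φ, Sum.elim_inr, hc, true_and, this]
        split_ifs
        · rfl
        · exact rotYMatrix_zero
      rw [this, mux_ite_comp_eq_zero f ht, if_pos hc, ← hE, onQubits_mul, onQubits_mul]
      have hcomm : (onQubit t (rotYMatrix θ) - 1) * onQubits f (circuitMatrix P).conjTranspose =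
          onQubits f (circuitMatrix P).conjTranspose * (onQubit t (rotYMatrix θ) - 1) := by
        rw [sub_mul, mul_sub, onQubit_mul_onQubits f ht, one_mul, mul_one]
      rw [add_mul, one_mul, mul_add, hPP, mul_assoc (onQubits f (Matrix.single 0 0 1)), hcomm]
      simp only [mul_assoc]
    · have : mux t (fun x => rotYMatrix (φ (Sum.elim x a))) = 1 := by
        rw [← mux_one t]
        congr 1
        funext x
        simp only [φ, Sum.elim_inr, hc, false_and, if_false, rotYMatrix_zero]
      rw [this, one_mul, hPP, if_neg hc]

theorem rankOne_mul_rankOne_of_dotProduct_eq_zero {u v : (K → Fin 2) → ℂ}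
    (h : star u ⬝ᵥ v = 0) : rankOne u * rankOne v = 0 := by
  rw [rankOne, rankOne, Matrix.vecMulVec_mul_vecMulVec, h]
  simp

/-- The dilation of `1 - h`, controlled by a work qubit, takes `O(4 ^ card K)` gates. -/
theorem exists_circuit_controlled_dilation (g : K ⊕ Unit ↪ Q) (h : Op K) (hh : h.PosSemidef)
    (hn : ‖h‖ ≤ 2) (c : W) :
    ∃ C : List (Gate (Q ⊕ W)), C.length ≤ 18 * 2 ^ (2 * Fintype.card K) ∧ ∀ a,
      circuitMatrix C * withWork Q a = withWork Q a * if a c = 1 then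
        onQubits g (dilation (1 - h)) else 1 := by
  obtain ⟨v, θ, hv, hsum, hdil⟩ := exists_dilation_eq h hh hn
  let f : K ↪ Q := Function.Embedding.inl.trans g
  let t : Q := g (Sum.inr ())
  have ht : t ∉ Set.range f := by
    rintro ⟨k, hk⟩
    exact Sum.inl_ne_inr (g.injective hk)
  -- Each factor is `1 + P i (R i - 1)` with mutually orthogonal projections `P i`, so cross terms
  -- vanish and the product is a sum. Over the whole basis `∑ P i = 1`, leaving `∑ P i R i`.
  have main : ∀ s : Finset (K → Fin 2), ∃ C : List (Gate (Q ⊕ W)),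
      C.length ≤ s.card * (18 * 2 ^ Fintype.card K) ∧ ∀ a,
      circuitMatrix C * withWork Q a = withWork Q a * if a c = 1 then
        1 + ∑ i ∈ s, onQubits f (rankOne (v i)) * (onQubit t (rotYMatrix (θ i)) - 1) else 1 := by
    intro s
    induction s using Finset.induction_on with
    | empty => exact ⟨[], by simp, fun a => by simp [circuitMatrix]⟩
    | insert j s hj ih =>
      obtain ⟨C, hl, hC⟩ := ih
      obtain ⟨D, hDl, hD⟩ := exists_circuit_controlled_rotation f ht (v j) (by simp [hv]) (θ j) c
      refine ⟨C ++ D, ?_, fun a => ?_⟩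
      · rw [List.length_append, Finset.card_insert_of_notMem hj, add_mul, one_mul]
        omega
      · rw [circuitMatrix_append, Matrix.mul_assoc, hC a, ← Matrix.mul_assoc, hD a,
          Matrix.mul_assoc]
        congr 1
        split_ifs
        · have hcross : ∀ i ∈ s,
              (onQubits f (rankOne (v j)) * (onQubit t (rotYMatrix (θ j)) - 1)) *
              (onQubits f (rankOne (v i)) * (onQubit t (rotYMatrix (θ i)) - 1)) = 0 := by
            intro i hi
            have hij : j ≠ i := fun e => hj (e ▸ hi)
            have hcomm : (onQubit t (rotYMatrix (θ j)) - 1) * onQubits f (rankOne (v i)) =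
                onQubits f (rankOne (v i)) * (onQubit t (rotYMatrix (θ j)) - 1) := by
              rw [sub_mul, mul_sub, onQubit_mul_onQubits f ht, one_mul, mul_one]
            rw [mul_assoc, ← mul_assoc (onQubit t _ - 1), hcomm, ← mul_assoc, ← mul_assoc,
              ← onQubits_mul, rankOne_mul_rankOne_of_dotProduct_eq_zero (by rw [hv, if_neg hij]),
              onQubits_zero, zero_mul, zero_mul]
          rw [Finset.sum_insert hj, add_mul, one_mul, mul_add, mul_one, Finset.mul_sum,
            Finset.sum_eq_zero hcross]
          abel
        · rw [mul_one]
  obtain ⟨C, hl, hC⟩ := main Finset.univ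
  refine ⟨C, ?_, fun a => ?_⟩
  · rw [Finset.card_univ, Fintype.card_fun, Fintype.card_fin] at hl
    refine hl.trans (le_of_eq ?_)
    ring
  · rw [hC a]
    congr 2
    have : (1 : Op Q) = ∑ i, onQubits f (rankOne (v i)) := by
      rw [← onQubits_sum, hsum, onQubits_one]
    simp only [mul_sub, mul_one]
    rw [Finset.sum_sub_distrib, ← this, add_sub_cancel]
    ext x y
    rw [Matrix.sum_apply]
    by_cases hxy : ∀ q, q ∉ Set.range g → x q = y q
    · rw [onQubits_apply_of_agree g _ hxy, hdil]
      refine Finset.sum_congr rfl fun i _ => ?_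
      rw [onQubits_mul_onQubit_apply f ht]
      · rfl
      · intro q h1 h2
        refine hxy q ?_
        rintro ⟨k | k, rfl⟩
        · exact h1 ⟨k, rfl⟩
        · exact h2 rfl
    · rw [onQubits_apply_of_not_agree g _ hxy]
      refine Finset.sum_eq_zero fun i _ => onQubits_mul_onQubit_apply_of_ne f _ _ _ _ fun h' =>
        hxy fun q hq => h' q ?_ ?_
      · rintro ⟨k, rfl⟩
        exact hq ⟨Sum.inl k, rfl⟩
      · rintro rfl
        exact hq ⟨Sum.inr (), rfl⟩

end DilationCircuit

/-! ### Selecting one of several operators by the state of some qubits -/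

section Select

variable {Q : Type} [Fintype Q] [DecidableEq Q]

/-- The projection onto the states with `x b = v`. -/
def bitProj (b : Q) (v : Fin 2) : Op Q := Matrix.diagonal fun x => if x b = v then 1 else 0

theorem bitProj_mul_self (b : Q) (v : Fin 2) : bitProj b v * bitProj b v = bitProj b v := by
  rw [bitProj, Matrix.diagonal_mul_diagonal]
  congr 1
  funext x
  split_ifs <;> simp

theorem bitProj_zero_mul_one (b : Q) : bitProj b 0 * bitProj b 1 = 0 := by
  rw [bitProj, bitProj, Matrix.diagonal_mul_diagonal, ← Matrix.diagonal_zero]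
  congr 1
  funext x
  by_cases h : x b = 0 <;> simp [h]

theorem bitProj_one_mul_zero (b : Q) : bitProj b 1 * bitProj b 0 = 0 := by
  rw [bitProj, bitProj, Matrix.diagonal_mul_diagonal, ← Matrix.diagonal_zero]
  congr 1
  funext x
  by_cases h : x b = 0 <;> simp [h]

theorem bitProj_zero_add_one (b : Q) : bitProj b 0 + bitProj b 1 = 1 := by
  rw [bitProj, bitProj, Matrix.diagonal_add, ← Matrix.diagonal_one]
  congr 1
  funext x
  by_cases h : x b = 0
  · simp [h]
  · have : x b = 1 := by omega
    simp [this]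

variable {W : Type} [Fintype W] [DecidableEq W]

/-- A circuit with control `p` from one with control `c`, where `c` is a work qubit in the state
`|0⟩`: the operator is applied if moreover the qubit `b` is in the state `v`. -/
theorem exists_circuit_and_control (b : Q) (v : Fin 2) {p c : W} (hpc : p ≠ c) (X : Op Q)
    (hX : X * bitProj b v = bitProj b v * X) (F : List (Gate (Q ⊕ W))) (P : Set (W → Fin 2))
    (hP : ∀ a ∈ P, a c = 0 ∧
      ∀ e, circuitMatrix F * withWork Q (Function.update a c e) =
        withWork Q (Function.update a c e) * if e = 1 then X else 1) :
    ∃ G : List (Gate (Q ⊕ W)), G.length ≤ F.length + 24 ∧ ∀ a ∈ P,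
      circuitMatrix G * withWork Q a =
        withWork Q a * if a p = 1 then X * bitProj b v + (1 - bitProj b v) else 1 := by
  -- A Toffoli onto `c`: the `Y` rotation by `π` sends `|0⟩` to `|1⟩` without sign, and `c` starts
  -- in `|0⟩`. With two controls it takes at most `12` gates, and it is run once forwards and once
  -- backwards.
  let θ : (Q ⊕ W → Fin 2) → ℝ := fun x =>
    if x (Sum.inr p) = 1 ∧ x (Sum.inl b) = v then Real.pi else 0
  obtain ⟨R, hR, hRl⟩ := exists_circuit_muxY (Sum.inr c : Q ⊕ W) {Sum.inr p, Sum.inl b}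
    (by simpa using hpc.symm) θ (fun x y h => by
      simp only [θ, h (Sum.inr p) (by simp), h (Sum.inl b) (by simp)])
  refine ⟨R ++ (F ++ invCircuit R), ?_, fun a ha => ?_⟩
  · have : (({Sum.inr p, Sum.inl b} : Finset (Q ⊕ W))).card ≤ 2 := Finset.card_le_two
    have h2 := Nat.pow_le_pow_right (n := 2) (by norm_num) this
    simp only [List.length_append, length_invCircuit]
    omega
  · obtain ⟨hac, hF⟩ := hP a ha
    have hpi : rotYMatrix Real.pi = !![0, -1; 1, 0] := by simp [rotYMatrix]
    have hRa : circuitMatrix R * withWork Q a =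
        if a p = 1 then withWork Q a * (1 - bitProj b v) +
          withWork Q (Function.update a c 1) * bitProj b v
        else withWork Q a := by
      rw [hR, mux_inr_mul_withWork, Fin.sum_univ_two, hac]
      · have h0 : Function.update a c 0 = a := by rw [← hac, Function.update_eq_self]
        rw [h0]
        by_cases hp : a p = 1
        · rw [if_pos hp]
          congr 2
          · rw [← bitProj_zero_add_one b, bitProj, bitProj, bitProj, Matrix.diagonal_add,
              Matrix.diagonal_sub]
            congr 1
            funext x
            have : x b = 0 ∨ x b = 1 := by omega
            simp only [θ, Sum.elim_inl, Sum.elim_inr, hp, true_and]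
            by_cases hx : x b = v
            · rw [if_pos hx, if_pos hx, hpi]; rcases this with h | h <;> simp [h]
            · rw [if_neg hx, if_neg hx, rotYMatrix_zero]; rcases this with h | h <;> simp [h]
          · rw [bitProj]
            congr 1
            funext x
            simp only [θ, Sum.elim_inl, Sum.elim_inr, hp, true_and]
            by_cases hx : x b = v
            · rw [if_pos hx, if_pos hx, hpi]; simp
            · rw [if_neg hx, if_neg hx, rotYMatrix_zero]; simp
        · rw [if_neg hp]
          simp [θ, hp, rotYMatrix_zero]
      · intro x e
        have : θ (Function.update x (Sum.inr c) e) = θ x := by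
          simp only [θ]
          rw [Function.update_of_ne (by simpa using hpc), Function.update_of_ne (by simp)]
        simp only [this]
    have hFa : circuitMatrix F * withWork Q a = withWork Q a := by
      have := hF 0
      rw [← hac, Function.update_eq_self, hac] at this
      simpa using this
    have hFa1 : circuitMatrix F * withWork Q (Function.update a c 1) =
        withWork Q (Function.update a c 1) * X := by
      simpa using hF 1
    have hU := circuitMatrix_conjTranspose_mul R
    rw [circuitMatrix_append, circuitMatrix_append, circuitMatrix_invCircuit, Matrix.mul_assoc,
      hRa]
    by_cases hp : a p = 1
    · rw [if_pos hp] at hRa ⊢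
      rw [if_pos hp]
      -- Since `X` preserves the value of `b`, computing the flag and running `F` equals applying
      -- the target operator and then computing the flag; the inverse of `R` therefore clears it.
      have key : circuitMatrix F * (withWork Q a * (1 - bitProj b v) +
          withWork Q (Function.update a c 1) * bitProj b v) =
          circuitMatrix R * (withWork Q a * (X * bitProj b v + (1 - bitProj b v))) := by
        have hD := bitProj_mul_self b v
        have h1 : (1 - bitProj b v) * (X * bitProj b v + (1 - bitProj b v)) = 1 - bitProj b v := by
          rw [hX]
          generalize bitProj b v = D at hD
          rw [mul_add, ← mul_assoc, sub_mul, one_mul, hD, sub_self, zero_mul, zero_add, mul_sub,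
            mul_one, sub_mul, one_mul, hD, sub_self, sub_zero]
        have h2 : bitProj b v * (X * bitProj b v + (1 - bitProj b v)) = X * bitProj b v := by
          rw [hX]
          generalize bitProj b v = D at hD
          rw [mul_add, ← mul_assoc, hD, mul_sub, mul_one, hD, sub_self, add_zero]
        rw [← Matrix.mul_assoc (circuitMatrix R), hRa, Matrix.add_mul, Matrix.mul_assoc, h1,
          Matrix.mul_assoc, h2, Matrix.mul_add, ← Matrix.mul_assoc, hFa, ← Matrix.mul_assoc, hFa1,
          Matrix.mul_assoc]
      rw [Matrix.mul_assoc, key, ← Matrix.mul_assoc, hU, Matrix.one_mul]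
    · rw [if_neg hp] at hRa ⊢
      rw [if_neg hp, Matrix.mul_one, Matrix.mul_assoc, hFa]
      conv_lhs => rw [← hRa]
      rw [← Matrix.mul_assoc, hU, Matrix.one_mul]

variable {k : ℕ}

/-- The operator `V l` for the label `l` whose first `m` bits are those of `l` and whose other bits
are the states of the qubits `b i`. -/
def selectFrom (b : Fin k → Q) (V : (Fin k → Fin 2) → Op Q) (m : ℕ) (l : Fin k → Fin 2) : Op Q :=
  Matrix.of fun x y => V (fun i => if (i : ℕ) < m then l i else x (b i)) x y

theorem mul_bitProj_apply (X : Op Q) (b : Q) (v : Fin 2) (x y : Q → Fin 2) :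
    (X * bitProj b v) x y = if y b = v then X x y else 0 := by
  rw [bitProj, Matrix.mul_diagonal]
  split_ifs <;> simp

theorem bitProj_mul_apply (X : Op Q) (b : Q) (v : Fin 2) (x y : Q → Fin 2) :
    (bitProj b v * X) x y = if x b = v then X x y else 0 := by
  rw [bitProj, Matrix.diagonal_mul]
  split_ifs <;> simp

/-- Every `V l` is block diagonal in the label qubits; this supplies the commutation needed by
`exists_circuit_and_control`. -/
theorem selectFrom_mul_bitProj (b : Fin k → Q) (V : (Fin k → Fin 2) → Op Q)
    (hV : ∀ l x y, V l x y ≠ 0 → ∀ i, x (b i) = y (b i)) (m : ℕ) (l : Fin k → Fin 2) (i : Fin k)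
    (v : Fin 2) :
    selectFrom b V m l * bitProj (b i) v = bitProj (b i) v * selectFrom b V m l := by
  ext x y
  rw [mul_bitProj_apply, bitProj_mul_apply, selectFrom, Matrix.of_apply]
  by_cases h : V (fun i : Fin k => if (i : ℕ) < m then l i else x (b i)) x y = 0
  · simp [h]
  · rw [hV _ x y h i]

/-- Fixing the next label bit to the value held by its qubit changes nothing, so the operator splits
over the two values of that bit. -/
theorem selectFrom_succ (b : Fin k → Q) (V : (Fin k → Fin 2) → Op Q)
    (hV : ∀ l x y, V l x y ≠ 0 → ∀ i, x (b i) = y (b i)) (m : Fin k) (l : Fin k → Fin 2) :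
    selectFrom b V m l =
      selectFrom b V (m + 1) (Function.update l m 0) * bitProj (b m) 0 +
      selectFrom b V (m + 1) (Function.update l m 1) * bitProj (b m) 1 := by
  have key : ∀ (x : Q → Fin 2),
      (fun i : Fin k => if (i : ℕ) < m + 1 then Function.update l m (x (b m)) i else x (b i)) =
        fun i : Fin k => if (i : ℕ) < m then l i else x (b i) := by
    intro x
    funext i
    by_cases him : i = m
    · subst him; simp
    · have : (i : ℕ) ≠ m := fun e => him (Fin.ext e)
      rw [Function.update_of_ne him]
      exact if_congr (by omega) rfl rfl
  ext x y
  rw [selectFrom_mul_bitProj b V hV, selectFrom_mul_bitProj b V hV, Matrix.add_apply,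
    bitProj_mul_apply, bitProj_mul_apply]
  simp only [selectFrom, Matrix.of_apply]
  rw [← key x]
  have : x (b m) = 0 ∨ x (b m) = 1 := by omega
  rcases this with h | h <;> simp [h]

/-- Unary iteration: from circuits for the `V l` controlled by the last work qubit, a circuit for
`∑ l, |l⟩⟨l| ⊗ V l`, with a constant number of further gates for each `l`. -/
theorem exists_circuit_selectFrom (b : Fin k → Q) (V : (Fin k → Fin 2) → Op Q)
    (hV : ∀ l x y, V l x y ≠ 0 → ∀ i, x (b i) = y (b i)) (L : ℕ)
    (hC : ∀ l, ∃ C : List (Gate (Q ⊕ Fin (k + 1))), C.length ≤ L ∧ ∀ a,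
      circuitMatrix C * withWork Q a = withWork Q a * if a (Fin.last k) = 1 then V l else 1)
    (d m : ℕ) (hm : m + d = k) (l : Fin k → Fin 2) :
    ∃ C : List (Gate (Q ⊕ Fin (k + 1))), C.length + 48 ≤ 2 ^ d * (L + 48) ∧ ∀ a,
      (∀ i : Fin (k + 1), m < i → a i = 0) →
      circuitMatrix C * withWork Q a =
        withWork Q a * if a ⟨m, by omega⟩ = 1 then selectFrom b V m l else 1 := by
  induction d generalizing m l with
  | zero =>
    obtain ⟨C, hl, hC⟩ := hC l
    refine ⟨C, by omega, fun a _ => ?_⟩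
    rw [hC a]
    obtain rfl : m = k := by omega
    have : selectFrom b V m l = V l := by
      ext x y
      simp [selectFrom]
    rw [this]
    rfl
  | succ d ih =>
    have hmk : m < k := by omega
    let m' : Fin k := ⟨m, hmk⟩
    -- `p` flags that the prefix of length `m` has been matched, `c` that its extension has. Work
    -- qubits beyond `p` are still `0`, so the recursive circuits can use them.
    let p : Fin (k + 1) := ⟨m, by omega⟩
    let c : Fin (k + 1) := ⟨m + 1, by omega⟩
    have hpc : p ≠ c := by simp [p, c]
    let P : Set (Fin (k + 1) → Fin 2) := {a | ∀ i : Fin (k + 1), m < i → a i = 0}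
    have half : ∀ v : Fin 2, ∃ G : List (Gate (Q ⊕ Fin (k + 1))),
        G.length + 24 ≤ 2 ^ d * (L + 48) ∧ ∀ a ∈ P, circuitMatrix G * withWork Q a =
          withWork Q a * if a p = 1 then
            selectFrom b V (m + 1) (Function.update l m' v) * bitProj (b m') v +
              (1 - bitProj (b m') v) else 1 := by
      intro v
      obtain ⟨F, hFl, hF⟩ := ih (m + 1) (by omega) (Function.update l m' v)
      obtain ⟨G, hGl, hG⟩ := exists_circuit_and_control (b m') v hpc
        (selectFrom b V (m + 1) (Function.update l m' v)) (selectFrom_mul_bitProj b V hV _ _ _ _)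
        F P (fun a ha => ⟨ha c (by simp [c]), fun e => by
          rw [hF (Function.update a c e)]
          · simp [c]
          · intro i hi
            rw [Function.update_of_ne, ha i (by omega)]
            intro e
            simp [e, c] at hi⟩)
      exact ⟨G, by omega, hG⟩
    obtain ⟨G0, hl0, hG0⟩ := half 0
    obtain ⟨G1, hl1, hG1⟩ := half 1
    refine ⟨G0 ++ G1, ?_, fun a ha => ?_⟩
    -- Each half adds `24` gates, so the length obeys `T ↦ 2T + 48`, and `T + 48` doubles.
    · rw [List.length_append, pow_succ, mul_assoc, mul_comm 2, ← mul_assoc]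
      omega
    · rw [circuitMatrix_append, Matrix.mul_assoc, hG0 a ha, ← Matrix.mul_assoc, hG1 a ha,
        Matrix.mul_assoc]
      congr 1
      change _ = if a p = 1 then selectFrom b V m' l else 1
      by_cases hp : a p = 1
      · simp only [if_pos hp]
        rw [selectFrom_succ b V hV m' l]
        -- Each half is the identity on the complementary value of the bit, so their product is the
        -- direct sum of the two blocks.
        have h0 := bitProj_mul_self (b m') 0
        have h1 := bitProj_mul_self (b m') 1
        have h01 := bitProj_zero_mul_one (b m')
        have h10 := bitProj_one_mul_zero (b m')
        have hs : 1 - bitProj (b m') 1 = bitProj (b m') 0 := by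
          rw [← bitProj_zero_add_one (b m'), add_sub_cancel_right]
        have hs' : 1 - bitProj (b m') 0 = bitProj (b m') 1 := by
          rw [← bitProj_zero_add_one (b m'), add_sub_cancel_left]
        rw [hs, hs', selectFrom_mul_bitProj b V hV _ (Function.update l m' 0)]
        simp only [m'] at *
        generalize selectFrom b V (m + 1) _ = X1
        generalize selectFrom b V (m + 1) _ = X0
        generalize bitProj (b _) 0 = D0 at *
        generalize bitProj (b _) 1 = D1 at *
        rw [add_mul, mul_add, mul_add, mul_assoc X1, ← mul_assoc D1, h10, zero_mul, mul_zero,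
          zero_add, mul_assoc X1, h1, ← mul_assoc D0, h0, h01, add_zero, add_comm]
      · simp only [if_neg hp, mul_one]

end Select

/-! ### The linear combination of unitaries -/

section Lcu

variable {n J : ℕ}

theorem label_injective (J : ℕ) : Function.Injective (label : Fin J → _) := by
  intro i j h
  refine Fin.ext (Nat.eq_of_testBit_eq fun m => ?_)
  by_cases hm : m < ctrlSize J
  · have := congrFun h ⟨m, hm⟩
    simp only [label] at this
    by_cases h1 : (i : ℕ).testBit m <;> by_cases h2 : (j : ℕ).testBit m <;> simp_all
  -- Bits beyond the control register vanish for every number below `J`.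
  · have hJ : J ≤ 2 ^ m := (Nat.le_pow_clog one_lt_two J).trans
      (Nat.pow_le_pow_right two_pos (not_lt.1 hm))
    rw [Nat.testBit_lt_two_pow (i.2.trans_le hJ), Nat.testBit_lt_two_pow (j.2.trans_le hJ)]

theorem ctrlProj_mul_apply (j : Fin J) (A : Op (Fin n ⊕ Anc J)) (x y : Fin n ⊕ Anc J → Fin 2) :
    (ctrlProj n j * A) x y = if x ∘ ctrlQubits n J = label j then A x y else 0 := by
  rw [ctrlProj, onQubits_mul_apply]
  split_ifs with h
  · rw [Finset.sum_eq_single (label j)]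
    · rw [h, Matrix.single_apply_same, one_mul, ← h, extend_self_of_agree _ fun _ _ => rfl]
    · intro u _ hu
      rw [Matrix.single_apply_of_ne _ _ _ _ _ fun e => hu e.2.symm, zero_mul]
    · simp
  · refine Finset.sum_eq_zero fun u _ => ?_
    rw [Matrix.single_apply_of_ne _ _ _ _ _ fun e => h e.1.symm, zero_mul]

/-- The operator that is selected by the state `l` of the control register. -/
noncomputable def selected (S : Fin J → Finset (Fin n)) (h : ∀ j, Op (S j))
    (l : Fin (ctrlSize J) → Fin 2) : Op (Fin n ⊕ Anc J) :=
  open Classical in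
  if hl : ∃ j : Fin J, label j = l then
    onQubits (dilationQubits J (S hl.choose)) (dilation (1 - h hl.choose))
  else 1

theorem selected_label (S : Fin J → Finset (Fin n)) (h : ∀ j, Op (S j)) (j : Fin J) :
    selected S h (label j) = onQubits (dilationQubits J (S j)) (dilation (1 - h j)) := by
  have hl : ∃ i : Fin J, label i = label j := ⟨j, rfl⟩
  rw [selected, dif_pos hl, label_injective J hl.choose_spec]

theorem ctrlQubits_notMem_range (S : Finset (Fin n)) (i : Fin (ctrlSize J)) :
    ctrlQubits n J i ∉ Set.range (dilationQubits J S) := by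
  rintro ⟨k | k, hk⟩
  · exact Sum.inl_ne_inr hk
  · exact Sum.inl_ne_inr (Sum.inr_injective hk)

/-- The dilations touch no control qubit. This is the block-diagonality that unary iteration
requires. -/
theorem selected_apply_ne_zero (S : Fin J → Finset (Fin n)) (h : ∀ j, Op (S j))
    (l : Fin (ctrlSize J) → Fin 2) (x y : Fin n ⊕ Anc J → Fin 2) (hxy : selected S h l x y ≠ 0)
    (i : Fin (ctrlSize J)) : x (ctrlQubits n J i) = y (ctrlQubits n J i) := by
  by_cases hl : ∃ j : Fin J, label j = l
  · obtain ⟨j, rfl⟩ := hl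
    rw [selected_label] at hxy
    by_contra hne
    exact hxy (onQubits_apply_of_not_agree _ _ fun h' => hne (h' _ (ctrlQubits_notMem_range _ i)))
  · rw [selected, dif_neg hl] at hxy
    by_contra hne
    refine hxy (Matrix.one_apply_ne ?_)
    rintro rfl
    exact hne rfl

theorem selectOp_apply (S : Fin J → Finset (Fin n)) (h : ∀ j, Op (S j))
    (x y : Fin n ⊕ Anc J → Fin 2) :
    selectOp S h x y = selected S h (x ∘ ctrlQubits n J) x y := by
  have h1 : ∀ j : Fin J, ctrlProj n j x y =
      if x ∘ ctrlQubits n J = label j then (1 : Op (Fin n ⊕ Anc J)) x y else 0 := fun j => by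
    rw [← ctrlProj_mul_apply, mul_one]
  rw [selectOp, Matrix.add_apply, Matrix.sub_apply, Matrix.sum_apply, Matrix.sum_apply]
  simp only [ctrlProj_mul_apply, h1]
  by_cases hl : ∃ j : Fin J, label j = x ∘ ctrlQubits n J
  · obtain ⟨j, hj⟩ := hl
    simp only [← hj, selected_label, (label_injective J).eq_iff]
    simp
  · have : ∀ j : Fin J, x ∘ ctrlQubits n J ≠ label j := fun j e => hl ⟨j, e.symm⟩
    rw [selected, dif_neg hl]
    simp [this]

/-- By minimality of the ceiling, half of the power is below `J`. For `J = 1` the logarithm is `0`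
and has no predecessor to use. -/
theorem two_pow_ctrlSize_le (hJ : 0 < J) : 2 ^ ctrlSize J ≤ 2 * J := by
  rcases Nat.lt_or_ge 1 J with h | h
  · have h0 : 0 < Nat.clog 2 J := Nat.clog_pos one_lt_two h
    have := Nat.pow_pred_clog_lt_self one_lt_two h
    have e : 2 ^ ctrlSize J = 2 ^ (Nat.clog 2 J).pred * 2 := by
      rw [← pow_succ]
      congr 1
      exact (Nat.succ_pred_eq_of_pos h0).symm
    omega
  · obtain rfl : J = 1 := by omega
    simp

/-- The select operator takes `O(J * 4 ^ s)` gates. -/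
theorem exists_circuit_selectOp {s : ℕ} (hJ : 0 < J) (S : Fin J → Finset (Fin n))
    (h : ∀ j, Op (S j)) (hS : ∀ j, (S j).card ≤ s) (hh : ∀ j, (h j).PosSemidef)
    (hn : ∀ j, ‖h j‖ ≤ 2) :
    ∃ C : List (Gate ((Fin n ⊕ Anc J) ⊕ Fin (ctrlSize J + 1))),
      C.length ≤ 132 * (J * 2 ^ (2 * s)) ∧
      circuitMatrix C * withWork (Fin n ⊕ Anc J) (0 : Fin (ctrlSize J + 1) → Fin 2) =
        withWork (Fin n ⊕ Anc J) (0 : Fin (ctrlSize J + 1) → Fin 2) * selectOp S h := by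
  have leaf : ∀ l, ∃ C : List (Gate ((Fin n ⊕ Anc J) ⊕ Fin (ctrlSize J + 1))),
      C.length ≤ 18 * 2 ^ (2 * s) ∧ ∀ a, circuitMatrix C * withWork (Fin n ⊕ Anc J) a =
        withWork (Fin n ⊕ Anc J) a *
          if a (Fin.last (ctrlSize J)) = 1 then selected S h l else 1 := by
    intro l
    by_cases hl : ∃ j : Fin J, label j = l
    · obtain ⟨j, rfl⟩ := hl
      obtain ⟨C, hCl, hC⟩ := exists_circuit_controlled_dilation (dilationQubits J (S j)) (h j)
        (hh j) (hn j) (Fin.last (ctrlSize J))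
      refine ⟨C, hCl.trans ?_, fun a => by rw [hC a, selected_label]⟩
      rw [Fintype.card_coe]
      exact Nat.mul_le_mul_left _ (Nat.pow_le_pow_right two_pos (Nat.mul_le_mul_left _ (hS j)))
    -- Control states without a label select the identity, which costs no gate.
    · refine ⟨[], by simp, fun a => ?_⟩
      rw [selected, dif_neg hl]
      simp [circuitMatrix]
  obtain ⟨C, hCl, hC⟩ := exists_circuit_selectFrom (fun i => ctrlQubits n J i) (selected S h)
    (selected_apply_ne_zero S h) _ leaf (ctrlSize J) 0 (by omega) 0
  have hsel : selectFrom (fun i => ctrlQubits n J i) (selected S h) 0 0 = selectOp S h := by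
    ext x y
    rw [selectOp_apply, selectFrom, Matrix.of_apply]
    simp only [not_lt_zero, if_false]
    rfl
  -- The empty prefix always matches, so the root flag is switched on by a `Y` rotation by `π` and
  -- switched off at the end.
  let a : Fin (ctrlSize J + 1) → Fin 2 := Function.update 0 0 1
  have ha := hC a fun i hi => by
    have : i ≠ 0 := by rintro rfl; simp at hi
    simp [a, this]
  rw [hsel, if_pos (by simp [a])] at ha
  let X : List (Gate ((Fin n ⊕ Anc J) ⊕ Fin (ctrlSize J + 1))) := [.rotY Real.pi (Sum.inr 0)]
  have hX : circuitMatrix X * withWork (Fin n ⊕ Anc J) (0 : Fin (ctrlSize J + 1) → Fin 2) =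
      withWork (Fin n ⊕ Anc J) a := by
    rw [circuitMatrix_singleton, Gate.matrix, onQubit_eq_mux,
      mux_inr_mul_withWork _ _ fun _ _ => rfl, Fin.sum_univ_two]
    simp [rotYMatrix, a]
  refine ⟨X ++ (C ++ invCircuit X), ?_, ?_⟩
  -- Here `132 = 2 * (18 + 48)`; the spare `48` in the bound for `C` absorbs the two gates on the
  -- root flag.
  · have h1 := two_pow_ctrlSize_le hJ
    have h2 : 1 ≤ 2 ^ (2 * s) := Nat.one_le_two_pow
    have h3 := Nat.mul_le_mul_right (18 * 2 ^ (2 * s) + 48) h1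
    have h4 : 2 * J * (18 * 2 ^ (2 * s) + 48) ≤ 2 * J * (18 * 2 ^ (2 * s) + 48 * 2 ^ (2 * s)) :=
      Nat.mul_le_mul_left _ (by omega)
    have h5 : 2 * J * (18 * 2 ^ (2 * s) + 48 * 2 ^ (2 * s)) = 132 * (J * 2 ^ (2 * s)) := by ring
    simp only [List.length_append, length_invCircuit, X, List.length_singleton]
    omega
  · rw [circuitMatrix_append, circuitMatrix_append, circuitMatrix_invCircuit, Matrix.mul_assoc, hX,
      Matrix.mul_assoc, ha, ← hX, Matrix.mul_assoc, ← Matrix.mul_assoc,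
      circuitMatrix_conjTranspose_mul, Matrix.one_mul]

/-- Only the column of `had` at the zero state matters, and `IsUniformPrep` prescribes exactly that
column. -/
theorem onQubits_had_mul_withWork {had : Op (Fin (ctrlSize J))} (hhad : IsUniformPrep J had) :
    onQubits (ctrlQubits n J) had * withWork (Fin n) (0 : Anc J → Fin 2) =
      ∑ j : Fin J, ((1 / Real.sqrt J : ℝ) : ℂ) •
        withWork (Fin n) (Sum.elim 0 (label j) : Anc J → Fin 2) := by
  refine ext_withWork fun x z y => ?_
  have hcol : ∀ l, had l 0 = ∑ j : Fin J, ((1 / Real.sqrt J : ℝ) : ℂ) *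
      if l = label j then 1 else 0 := fun l => by
    have := congrFun hhad.2 l
    simpa [Pi.single_apply] using this
  rw [mul_withWork_apply, Matrix.sum_apply]
  simp only [Matrix.smul_apply, smul_eq_mul, withWork, Matrix.of_apply, elim_eq_elim_iff]
  by_cases hxy : x = y ∧ z (Sum.inl ()) = 0
  · rw [onQubits_apply_of_agree]
    · refine (hcol _).trans (Finset.sum_congr rfl fun j _ => ?_)
      congr 1
      refine if_congr ⟨fun e => ⟨hxy.1, ?_⟩, fun e => ?_⟩ rfl rfl
      · funext r
        rcases r with r | r
        · exact hxy.2
        · exact congrFun e r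
      · rw [e.2]
        rfl
    · rintro (q | q | q) hq
      · exact congrFun hxy.1 q
      · exact hxy.2
      · exact absurd ⟨q, rfl⟩ hq
  · rw [onQubits_apply_of_not_agree]
    · symm
      refine Finset.sum_eq_zero fun j _ => ?_
      rw [if_neg, mul_zero]
      rintro ⟨rfl, rfl⟩
      exact hxy ⟨rfl, rfl⟩
    · intro h'
      refine hxy ⟨funext fun q => h' (Sum.inl q) ?_, h' (Sum.inr (Sum.inl ())) ?_⟩
      · rintro ⟨k, hk⟩
        exact Sum.inr_ne_inl hk
      · rintro ⟨k, hk⟩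
        exact Sum.inr_ne_inl (Sum.inr_injective hk)

theorem withWork_conjTranspose_mul_apply {Q W ι : Type} [Fintype Q] [DecidableEq Q] [Fintype W]
    [DecidableEq W] (a : W → Fin 2) (M : Matrix (Q ⊕ W → Fin 2) ι ℂ) (x : Q → Fin 2) (i : ι) :
    ((withWork Q a).conjTranspose * M) x i = M (Sum.elim x a) i := by
  simp [Matrix.mul_apply, withWork, apply_ite]

/-- Distinct labels are not mixed by the select operator; for equal labels, the dilation ancilla at
`0` on both sides picks the top-left block. -/
theorem withWork_conjTranspose_mul_selectOp_mul (S : Fin J → Finset (Fin n)) (h : ∀ j, Op (S j))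
    (i j : Fin J) :
    (withWork (Fin n) (Sum.elim 0 (label i) : Anc J → Fin 2)).conjTranspose *
        (selectOp S h * withWork (Fin n) (Sum.elim 0 (label j) : Anc J → Fin 2)) =
      if i = j then localTerm (S i) (1 - h i) else 0 := by
  ext x y
  rw [withWork_conjTranspose_mul_apply, mul_withWork_apply, selectOp_apply]
  have hl : ((Sum.elim x (Sum.elim 0 (label i)) : Fin n ⊕ Anc J → Fin 2)) ∘ ctrlQubits n J =
    label i := rfl
  rw [hl]
  by_cases hij : i = j
  · subst hij
    rw [if_pos rfl, selected_label, localTerm]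
    by_cases hxy : ∀ q, q ∉ Set.range (Function.Embedding.subtype (· ∈ S i)) → x q = y q
    · rw [onQubits_apply_of_agree _ _ hxy, onQubits_apply_of_agree, dilation_apply]
      · rfl
      · rintro (q | q) hq
        · refine hxy q ?_
          rintro ⟨k, rfl⟩
          exact hq ⟨Sum.inl k, rfl⟩
        · rfl
    · rw [onQubits_apply_of_not_agree _ _ hxy, onQubits_apply_of_not_agree]
      refine fun h' => hxy fun q hq => h' (Sum.inl q) ?_
      rintro ⟨k | k, hk⟩
      · exact hq ⟨k, Sum.inl_injective hk⟩
      · exact Sum.inr_ne_inl hk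
  · rw [if_neg hij]
    by_contra hne
    refine hij (label_injective J (funext fun q => ?_))
    exact selected_apply_ne_zero S h _ _ _ hne q

theorem ofReal_one_div_sqrt_mul_self (J : ℕ) :
    ((1 / Real.sqrt J : ℝ) : ℂ) * ((1 / Real.sqrt J : ℝ) : ℂ) = 1 / (J : ℂ) := by
  rw [← Complex.ofReal_mul, div_mul_div_comm, Real.mul_self_sqrt (Nat.cast_nonneg _)]
  simp

theorem localTerm_one_sub (S : Finset (Fin n)) (h : Op S) :
    localTerm S (1 - h) = 1 - localTerm S h := by
  rw [localTerm, onQubits_sub, onQubits_one, localTerm]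

theorem zeroBlock_lcuOp (hJ : 0 < J) {had : Op (Fin (ctrlSize J))} (hhad : IsUniformPrep J had)
    (S : Fin J → Finset (Fin n)) (h : ∀ j, Op (S j)) :
    zeroBlock (lcuOp had S h) = 1 - (1 / (J : ℂ)) • ∑ j, localTerm (S j) (h j) := by
  have hz : zeroBlock (lcuOp had S h) = (withWork (Fin n) (0 : Anc J → Fin 2)).conjTranspose *
      (lcuOp had S h * withWork (Fin n) (0 : Anc J → Fin 2)) := by
    ext x y
    rw [withWork_conjTranspose_mul_apply, mul_withWork_apply]
    rfl
  have hJ' : (J : ℂ) ≠ 0 := Nat.cast_ne_zero.2 hJ.ne'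
  have hadj : (withWork (Fin n) (0 : Anc J → Fin 2)).conjTranspose *
      (onQubits (ctrlQubits n J) had).conjTranspose = ∑ j : Fin J, ((1 / Real.sqrt J : ℝ) : ℂ) •
        (withWork (Fin n) (Sum.elim 0 (label j) : Anc J → Fin 2)).conjTranspose := by
    rw [← Matrix.conjTranspose_mul, onQubits_had_mul_withWork hhad, Matrix.conjTranspose_sum]
    refine Finset.sum_congr rfl fun j _ => ?_
    rw [Matrix.conjTranspose_smul]
    congr 1
    exact Complex.conj_ofReal _
  rw [hz, lcuOp, onQubits_conjTranspose, Matrix.mul_assoc, Matrix.mul_assoc,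
    onQubits_had_mul_withWork hhad, ← Matrix.mul_assoc, hadj]
  simp only [Matrix.sum_mul, Matrix.mul_sum, Matrix.smul_mul, Matrix.mul_smul,
    withWork_conjTranspose_mul_selectOp_mul, smul_ite, smul_zero]
  simp only [Finset.sum_ite_eq', Finset.mem_univ, if_true, localTerm_one_sub]
  rw [← Finset.smul_sum, ← Finset.smul_sum, smul_smul, ofReal_one_div_sqrt_mul_self,
    Finset.sum_sub_distrib, smul_sub]
  congr 1
  rw [Finset.sum_const, Finset.card_univ, Fintype.card_fin, ← Nat.cast_smul_eq_nsmul ℂ, smul_smul,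
    one_div, inv_mul_cancel₀ hJ', one_smul]

/-- The preparation of the uniform superposition takes `O(J)` gates up to a phase. -/
theorem exists_circuit_isUniformPrep (hJ : 0 < J) :
    ∃ (C : List (Gate (Fin (ctrlSize J)))) (c : ℂ), star c * c = 1 ∧
      IsUniformPrep J (c • circuitMatrix C) ∧ C.length ≤ 12 * J := by
  let v : (Fin (ctrlSize J) → Fin 2) → ℂ :=
    ∑ j : Fin J, ((1 / Real.sqrt J : ℝ) : ℂ) • Pi.single (label j) 1
  have hv : star v ⬝ᵥ v = 1 := by
    have hJ' : (J : ℂ) ≠ 0 := Nat.cast_ne_zero.2 hJ.ne'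
    have hvl : ∀ j : Fin J, v (label j) = ((1 / Real.sqrt J : ℝ) : ℂ) := fun j => by
      simp only [v, Finset.sum_apply, Pi.smul_apply, Pi.single_apply,
        (label_injective J).eq_iff]
      simp
    have hstar : ∀ j : Fin J, star v (label j) = ((1 / Real.sqrt J : ℝ) : ℂ) := fun j => by
      rw [Pi.star_apply, hvl]
      exact Complex.conj_ofReal _
    have hsum : ∀ u : (Fin (ctrlSize J) → Fin 2) → ℂ, u ⬝ᵥ v =
        ∑ j : Fin J, ((1 / Real.sqrt J : ℝ) : ℂ) * u (label j) := fun u => by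
      simp only [v, dotProduct_sum, dotProduct_smul, dotProduct_single, mul_one, smul_eq_mul]
    simp only [hsum, hstar, ofReal_one_div_sqrt_mul_self]
    rw [Finset.sum_const, Finset.card_univ, Fintype.card_fin, nsmul_eq_mul, mul_one_div_cancel hJ']
  obtain ⟨C, c, hC, hc, hl⟩ := exists_circuit_prepare_unit v hv
  refine ⟨C, c, hc, ⟨?_, ?_⟩, ?_⟩
  · rw [Matrix.mem_unitaryGroup_iff', Matrix.star_eq_conjTranspose, Matrix.conjTranspose_smul,
      Matrix.smul_mul, Matrix.mul_smul, smul_smul, circuitMatrix_conjTranspose_mul, hc, one_smul]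
  · rw [Matrix.smul_mulVec, ← hC]
  -- Preparation takes `6 * 2 ^ ctrlSize J` gates, and the power is at most `2 * J`.
  · rw [Fintype.card_fin] at hl
    have := two_pow_ctrlSize_le hJ
    omega

/-- `Had` occurs once with its adjoint and once without, so the phase left open by state preparation
cancels and needs no gate. -/
theorem lcuOp_smul {c : ℂ} (hc : star c * c = 1) (had : Op (Fin (ctrlSize J)))
    (S : Fin J → Finset (Fin n)) (h : ∀ j, Op (S j)) :
    lcuOp (c • had) S h = lcuOp had S h := by
  rw [lcuOp, lcuOp, Matrix.conjTranspose_smul, onQubits_smul, onQubits_smul, Matrix.smul_mul,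
    Matrix.smul_mul, Matrix.mul_smul, smul_smul, hc, one_smul]

end Lcu

end BlockEnc

/-! ### The block-encoding and its circuit -/

open BlockEnc in
theorem mainTheorem7 :
    ∃ C : ℕ, ∀ (n s J : ℕ), 0 < J →
      ∀ (S : Fin J → Finset (Fin n)) (h : ∀ j, Op (S j)),
        (∀ j, (S j).card ≤ s) → (∀ j, (h j).PosSemidef) → (∀ j, ‖h j‖ ≤ 2) →
        ∀ A : Op (Fin n), A = ∑ j, localTerm (S j) (h j) →
          (∀ had, IsUniformPrep J had →
            IsMatrixBlockEncoding 1 (Nat.clog 2 J + 1) 0 (lcuOp had S h)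
              (1 - (1 / (J : ℂ)) • A)) ∧
          ∃ had, IsUniformPrep J had ∧
            ∃ (w : ℕ) (circ : List (Gate ((Fin n ⊕ Anc J) ⊕ Fin w))),
              Implements circ (lcuOp had S h) ∧ circ.length ≤ C * (J * 2 ^ (2 * s)) := by
  -- `156 = 132 + 2 * 12`: the select circuit, and the preparation run forwards and backwards.
  refine ⟨156, fun n s J hJ S h hS hh hn A hA => ?_⟩
  obtain ⟨F, hFl, hF⟩ := exists_circuit_selectOp hJ S h hS hh hn
  refine ⟨fun had hhad => ⟨?_, ?_, ?_⟩, ?_⟩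
  · simp [add_comm]
  · have hH := onQubits_mem_unitaryGroup (ctrlQubits n J) hhad.1
    have hH' := onQubits_mem_unitaryGroup (ctrlQubits n J) (Unitary.star_mem hhad.1)
    -- Unitarity of the select operator comes from its circuit, not from a computation with the
    -- dilations.
    exact mul_mem (mul_mem hH' (mem_unitaryGroup_of_circuitMatrix_mul hF)) hH
  · rw [zeroBlock_lcuOp hJ hhad, hA]
    simp
  · obtain ⟨P, c, hc, hP, hPl⟩ := exists_circuit_isUniformPrep hJ
    refine ⟨c • circuitMatrix P, hP, ctrlSize J + 1, ?_⟩
    let P' : List (Gate ((Fin n ⊕ Anc J) ⊕ Fin (ctrlSize J + 1))) :=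
      P.map (Gate.map (intoSystem (Fin (ctrlSize J + 1)) (ctrlQubits n J)))
    refine ⟨P' ++ (F ++ invCircuit P'), ?_, ?_⟩
    · rw [implements_iff, lcuOp_smul hc, lcuOp, circuitMatrix_append, circuitMatrix_append,
        circuitMatrix_invCircuit, circuitMatrix_map, ← onQubits_conjTranspose, Matrix.mul_assoc,
        onQubits_intoSystem_mul_withWork, Matrix.mul_assoc, ← Matrix.mul_assoc (circuitMatrix F), hF,
        ← Matrix.mul_assoc, ← Matrix.mul_assoc, onQubits_intoSystem_mul_withWork]
      simp only [Matrix.mul_assoc]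
    · have h1 : J * 1 ≤ J * 2 ^ (2 * s) := Nat.mul_le_mul_left _ Nat.one_le_two_pow
      simp only [List.length_append, length_invCircuit, P', List.length_map]
      omega
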